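/- Let $p\in[1,\infty)$, let $G$ be a countable discrete abelian group with counting measure, and let $\hat G$ be its (compact) dual group with normalized Haar measure $\mu$. Let $A$ be a separable unital $L^p$ operator algebra (a Banach algebra with an isometric representation on some $L^p$ space) which has unique $L^p$ operator matrix norms: any two isometric representations of $A$ on separable $L^p$ spaces of $\sigma$-finite measures induce the same norms on all matrix algebras $M_n(A)$, where a matrix of operators on $L^p(X,\nu)$ acts on $L^p(\{1,\dots,n\}\times X)$. Let $\alpha$ be an action of $G$ on $A$ by isometric automorphisms. For a locally compact group $K$ with left Haar measure $\mu_K$ and a strongly continuous action $\tau$ of $K$ on a Banach algebra $B$ by isometric automorphisms, let $F^p(K,B,\tau)$ denote the full $L^p$ operator crossed product: the (Hausdorff) completion of $C_c(K,B)$, with the twisted convolution $(f*g)(t)=\int_K f(s)\,\tau_s(g(s^{-1}t))\,d\mu_K(s)$, in the seminorm $\|f\|=\sup\|(\pi\rtimes v)(f)\|$, where $(\pi\rtimes v)(f)\xi=\int_K\pi(f(t))v_t\xi\,d\mu_K(t)$ and the supremum runs over all pairs $(\pi,v)$ consisting of a nondegenerate contractive representation $\pi$ of $B$ on the $L^p$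 space of a $\sigma$-finite measure and a strongly continuous representation $v$ of $K$ by invertible isometries of the same space with $v_t\pi(b)v_{t^{-1}}=\pi(\tau_t(b))$. Let $\hat\alpha$ be the action of $\hat G$ on $F^p(G,A,\alpha)$ determined by $\hat\alpha_\gamma(f)(s)=\overline{\gamma(s)}f(s)$ for $f\in C_c(G,A)$, let $\beta$ be the trivial action of $\hat G$ on $A$, and let $\hat\beta\otimes\alpha$ be the action of $G$ on $F^p(\hat G,A,\beta)$ determined by $(\hat\beta\otimes\alpha)_s(\varphi)(\gamma)=\gamma(s)\,\alpha_s(\varphi(\gamma))$ for $\varphi\in C(\hat G,A)$. A function $F\in C_c(\hat G\times G,A)$ defines the element $\gamma\mapsto F(\gamma,\cdot)$ of $F^p(\hat G,F^p(G,A,\alpha),\hat\alpha)$, and a function in $C_c(G\times\hat G,A)$ defines in the same way an element of $F^p(G,F^p(\hat G,A,\beta),\hat\beta\otimes\alpha)$. **Proposition (label change).** The map $$\Phi_1(F)(s,\gamma)=\gamma(s)F(\gamma,s),\qquad F\in C_c(\hat G\times G,A),\ s\in G,\ \gamma\in\hat G,$$ extends uniquely to an isometric algebra isomorphism $$\Phi_1:F^p(\hat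 G,F^p(G,A,\alpha),\hat\alpha)\longrightarrow F^p(G,F^p(\hat G,A,\beta),\hat\beta\otimes\alpha)$$ of the first algebra onto the second. -/

import Mathlib

open MeasureTheory Topology UniformSpace
open scoped ENNReal CompactlySupported

universe u v w

set_option linter.unusedSectionVars false

noncomputable section

namespace LpCrossed

/-! ### Generic facts about completions and strongly continuous families of isometries -/

section Generic

variable (R : Type u) [NonUnitalSeminormedRing R]

/-- The extension by continuity of the product of a (non-unital) seminormed ring to its
completion. -/
def completionMul : Completion R → Completion R → Completion R :=
  Function.curry <| (Completion.isDenseInducing_coe.prodMap Completion.isDenseInducing_coe).extend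
    ((fun x : R => (x : Completion R)) ∘ Function.uncurry (fun x y : R => x * y))

variable {R} in
theorem completionMul_coe (a b : R) :
    completionMul R (a : Completion R) (b : Completion R) = ((a * b : R) : Completion R) :=
  (Completion.isDenseInducing_coe.prodMap Completion.isDenseInducing_coe).extend_eq
    ((Completion.continuous_coe R).comp (continuous_mul (M := R))) (a, b)

theorem continuous_completionMul :
    Continuous fun q : Completion R × Completion R => completionMul R q.1 q.2 := by
  let m := (AddMonoidHom.mul : R →+ R →+ R).compr₂ Completion.toCompl
  have hm : Continuous fun q : R × R => m q.1 q.2 :=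
    (Completion.continuous_coe R).comp continuous_mul
  have di : IsDenseInducing (Completion.toCompl : R → Completion R) :=
    Completion.isDenseInducing_coe
  exact (di.extend_Z_bilin di hm :)

variable {R} in
theorem continuous_completionMul_comp {T : Type*} [TopologicalSpace T] {f g : T → Completion R}
    (hf : Continuous f) (hg : Continuous g) : Continuous fun t => completionMul R (f t) (g t) :=
  (continuous_completionMul R).comp (hf.prodMk hg)

variable {R} in
theorem completionMul_assoc (a b c : Completion R) :
    completionMul R (completionMul R a b) c = completionMul R a (completionMul R b c) := by
  refine Completion.induction_on₃ a b c (isClosed_eq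
    (continuous_completionMul_comp (continuous_completionMul_comp continuous_fst
      continuous_snd.fst) continuous_snd.snd)
    (continuous_completionMul_comp continuous_fst
      (continuous_completionMul_comp continuous_snd.fst continuous_snd.snd))) fun a b c => ?_
  simp only [completionMul_coe, mul_assoc]

variable {R} in
theorem completionMul_add (a b c : Completion R) :
    completionMul R a (b + c) = completionMul R a b + completionMul R a c := by
  refine Completion.induction_on₃ a b c (isClosed_eq
    (continuous_completionMul_comp continuous_fst (continuous_snd.fst.add continuous_snd.snd))
    ((continuous_completionMul_comp continuous_fst continuous_snd.fst).add
      (continuous_completionMul_comp continuous_fst continuous_snd.snd))) fun a b c => ?_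
  simp only [completionMul_coe, ← Completion.coe_add, mul_add]

variable {R} in
theorem add_completionMul (a b c : Completion R) :
    completionMul R (a + b) c = completionMul R a c + completionMul R b c := by
  refine Completion.induction_on₃ a b c (isClosed_eq
    (continuous_completionMul_comp (continuous_fst.add continuous_snd.fst) continuous_snd.snd)
    ((continuous_completionMul_comp continuous_fst continuous_snd.snd).add
      (continuous_completionMul_comp continuous_snd.fst continuous_snd.snd))) fun a b c => ?_
  simp only [completionMul_coe, ← Completion.coe_add, add_mul]

variable {R} in
theorem norm_completionMul_le (a b : Completion R) : ‖completionMul R a b‖ ≤ ‖a‖ * ‖b‖ := by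
  refine Completion.induction_on₂ a b (isClosed_le
    (continuous_completionMul R).norm (by fun_prop)) fun a b => ?_
  rw [completionMul_coe, Completion.norm_coe, Completion.norm_coe, Completion.norm_coe]
  exact norm_mul_le a b

variable {R} in
theorem completionMul_zero (a : Completion R) : completionMul R a 0 = 0 := by
  have := completionMul_add a 0 0
  rwa [add_zero, left_eq_add] at this

variable {R} in
theorem zero_completionMul (a : Completion R) : completionMul R 0 a = 0 := by
  have := add_completionMul 0 0 a
  rwa [add_zero, left_eq_add] at this

/-- A strongly continuous family of linear isometries is jointly continuous. -/
theorem continuous_isometry_apply {T E : Type*} [TopologicalSpace T] [NormedAddCommGroup E]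
    [NormedSpace ℂ E] (V : T → E ≃ₗᵢ[ℂ] E) (hV : ∀ x, Continuous fun t => V t x) :
    Continuous fun q : T × E => V q.1 q.2 := by
  rw [continuous_iff_continuousAt]
  rintro ⟨t₀, x₀⟩
  rw [ContinuousAt, tendsto_iff_norm_sub_tendsto_zero]
  have h1 : Filter.Tendsto (fun q : T × E => ‖q.2 - x₀‖ + ‖V q.1 x₀ - V t₀ x₀‖) (𝓝 (t₀, x₀))
      (𝓝 0) := by
    have : Continuous fun q : T × E => ‖q.2 - x₀‖ + ‖V q.1 x₀ - V t₀ x₀‖ := by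
      have := (hV x₀).comp (continuous_fst : Continuous (Prod.fst : T × E → T))
      simp only [Function.comp_def] at this
      fun_prop
    simpa using this.tendsto (t₀, x₀)
  refine squeeze_zero (fun _ => norm_nonneg _) (fun q => ?_) h1
  have h2 := norm_sub_le_norm_sub_add_norm_sub (V q.1 q.2) (V q.1 x₀) (V t₀ x₀)
  rwa [← LinearIsometryEquiv.map_sub, LinearIsometryEquiv.norm_map] at h2

/-- A continuous function vanishing outside a compact set of pairs `(r * s, r)`. -/
theorem hasCompactSupport_of_convolution {G F E : Type*} [Group G] [TopologicalSpace G]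
    [IsTopologicalGroup G] [Zero F] [Zero E] [TopologicalSpace F] (f g : C_c(G, F))
    {Ψ : G × G → E} (h : ∀ s r, (f r = 0 ∨ g (r⁻¹ * s) = 0) → Ψ (s, r) = 0) :
    HasCompactSupport Ψ := by
  have hK : IsCompact ((fun q : G × G => (q.1 * q.2, q.1)) '' (tsupport f ×ˢ tsupport g)) :=
    (f.hasCompactSupport.isCompact.prod g.hasCompactSupport.isCompact).image (by fun_prop)
  refine HasCompactSupport.intro hK ?_
  rintro ⟨s, r⟩ hq
  apply h
  by_contra hcon
  push Not at hcon
  exact hq ⟨(r, r⁻¹ * s), ⟨subset_tsupport _ hcon.1, subset_tsupport _ hcon.2⟩, by simp⟩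

end Generic

/-! ### Actions, covariant representations, and the convolution algebra -/

/-- A continuous action of a topological group on a Banach algebra by isometric
automorphisms. -/
structure IsoAction (G : Type u) (A : Type v) [Group G] [TopologicalSpace G]
    [NonUnitalNormedRing A] [NormedSpace ℂ A] where
  /-- the underlying homomorphism into the group of linear isometries -/
  toHom : G →* (A ≃ₗᵢ[ℂ] A)
  map_mul' : ∀ g a b, toHom g (a * b) = toHom g a * toHom g b
  continuous' : ∀ a, Continuous fun g => toHom g a

section Basic

variable {G : Type u} [Group G] [TopologicalSpace G]
  {A : Type v} [NonUnitalNormedRing A] [NormedSpace ℂ A]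

namespace IsoAction

instance : CoeFun (IsoAction G A) fun _ => G → (A ≃ₗᵢ[ℂ] A) := ⟨fun α => α.toHom⟩

variable (α : IsoAction G A)

theorem apply_mul (g h : G) (a : A) : α (g * h) a = α g (α h a) := by
  rw [map_mul]; rfl

theorem joint : Continuous fun q : G × A => α q.1 q.2 :=
  continuous_isometry_apply _ α.continuous'

variable (G A) in
/-- The trivial action. -/
def trivial : IsoAction G A where
  toHom := 1
  map_mul' _ _ _ := rfl
  continuous' _ := continuous_const

@[simp] theorem trivial_apply (g : G) (a : A) : trivial G A g a = a := rfl

end IsoAction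

variable (p : ℝ≥0∞) [Fact (1 ≤ p)]

/-- A nondegenerate `σ`-finite contractive covariant representation of `(G, A, α)` on an
`L^p` space. -/
structure CovRep (α : IsoAction G A) : Type (max u v (w + 1)) where
  /-- the underlying space -/
  X : Type w
  [mX : MeasurableSpace X]
  /-- the measure -/
  ν : Measure X
  [sigmaFinite : SigmaFinite ν]
  /-- the representation of the algebra -/
  π : A →ₙₐ[ℂ] (Lp ℂ p ν →L[ℂ] Lp ℂ p ν)
  contractive : ∀ a, ‖π a‖ ≤ ‖a‖
  nondegenerate : (Submodule.span ℂ {η | ∃ a ξ, η = π a ξ}).topologicalClosure = ⊤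
  /-- the isometric representation of the group -/
  V : G →* (Lp ℂ p ν ≃ₗᵢ[ℂ] Lp ℂ p ν)
  continuous_V : ∀ ξ, Continuous fun t => V t ξ
  covariant : ∀ t a ξ, V t (π a (V t⁻¹ ξ)) = π (α t a) ξ

namespace CovRep

attribute [instance] CovRep.mX CovRep.sigmaFinite

variable {p} {α : IsoAction G A} (ρ : CovRep.{u, v, w} p α)

/-- The `L^p` space on which a covariant representation acts. -/
abbrev E : Type w := Lp ℂ p ρ.ν

/-- The representation of the algebra as a bounded linear map. -/
def πL : A →L[ℂ] (ρ.E →L[ℂ] ρ.E) :=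
  LinearMap.mkContinuous
    { toFun := ρ.π
      map_add' := map_add ρ.π
      map_smul' := fun c a => map_smul ρ.π c a } 1
    (fun a => by simpa using ρ.contractive a)

@[simp] theorem πL_apply (a : A) : ρ.πL a = ρ.π a := rfl

theorem norm_π_apply_le (a : A) (ξ : ρ.E) : ‖ρ.π a ξ‖ ≤ ‖a‖ * ‖ξ‖ :=
  ((ρ.π a).le_opNorm ξ).trans (by gcongr; exact ρ.contractive a)

theorem joint_V : Continuous fun q : G × ρ.E => ρ.V q.1 q.2 :=
  continuous_isometry_apply _ ρ.continuous_V

theorem V_mul (s t : G) (ξ : ρ.E) : ρ.V (s * t) ξ = ρ.V s (ρ.V t ξ) := by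
  rw [map_mul]; rfl

theorem V_π (t : G) (a : A) (ξ : ρ.E) : ρ.V t (ρ.π a ξ) = ρ.π (α t a) (ρ.V t ξ) := by
  rw [← ρ.covariant, ← V_mul, inv_mul_cancel, map_one]; rfl

theorem continuous_integrand {T : Type*} [TopologicalSpace T] {b : T → A} {τ : T → G}
    {x : T → ρ.E} (hb : Continuous b) (hτ : Continuous τ) (hx : Continuous x) :
    Continuous fun t => ρ.π (b t) (ρ.V (τ t) (x t)) := by
  have h2 : Continuous fun t => ρ.V (τ t) (x t) := ρ.joint_V.comp (hτ.prodMk hx)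
  exact (ρ.πL.continuous.comp hb).clm_apply h2

variable [MeasurableSpace G] [BorelSpace G] (μ : Measure G)
  [μ.IsHaarMeasure]

theorem integrable_integrand (f : C_c(G, A)) (ξ : ρ.E) :
    Integrable (fun t => ρ.π (f t) (ρ.V t ξ)) μ :=
  (ρ.continuous_integrand f.continuous continuous_id continuous_const).integrable_of_hasCompactSupport
    (f.hasCompactSupport.mono fun t ht => by
      contrapose! ht
      simp only [Function.mem_support, not_not] at ht ⊢
      simp [ht])

theorem integrable_norm (f : C_c(G, A)) : Integrable (fun t => ‖f t‖) μ :=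
  (f.continuous.integrable_of_hasCompactSupport f.hasCompactSupport).norm

/-- The integrated form of a covariant representation,
`f ↦ (ξ ↦ ∫ π(f t) (V_t ξ) dμ(t))`. -/
def integrated (f : C_c(G, A)) : ρ.E →L[ℂ] ρ.E :=
  LinearMap.mkContinuous
    { toFun := fun ξ => ∫ t, ρ.π (f t) (ρ.V t ξ) ∂μ
      map_add' := fun ξ η => by
        simp only [map_add]
        exact integral_add (ρ.integrable_integrand μ f ξ) (ρ.integrable_integrand μ f η)
      map_smul' := fun c ξ => by
        simp only [map_smul, RingHom.id_apply]
        exact integral_smul c _ } (∫ t, ‖f t‖ ∂μ)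
    (fun ξ => by
      simp only [LinearMap.coe_mk, AddHom.coe_mk]
      rw [← integral_mul_const]
      refine norm_integral_le_of_norm_le ((integrable_norm μ f).mul_const _)
        (Filter.Eventually.of_forall fun t => ?_)
      simpa using ρ.norm_π_apply_le (f t) (ρ.V t ξ))

theorem integrated_apply (f : C_c(G, A)) (ξ : ρ.E) :
    ρ.integrated μ f ξ = ∫ t, ρ.π (f t) (ρ.V t ξ) ∂μ := rfl

theorem norm_integrated_le (f : C_c(G, A)) : ‖ρ.integrated μ f‖ ≤ ∫ t, ‖f t‖ ∂μ :=
  LinearMap.mkContinuous_norm_le _ (integral_nonneg fun _ => norm_nonneg _) _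

theorem integrated_add (f g : C_c(G, A)) :
    ρ.integrated μ (f + g) = ρ.integrated μ f + ρ.integrated μ g := by
  ext1 ξ
  simp only [integrated_apply, add_apply,
    CompactlySupportedContinuousMap.coe_add, Pi.add_apply, map_add]
  exact integral_add (ρ.integrable_integrand μ f ξ) (ρ.integrable_integrand μ g ξ)

theorem integrated_smul (c : ℂ) (f : C_c(G, A)) :
    ρ.integrated μ (c • f) = c • ρ.integrated μ f := by
  ext1 ξ
  simp only [integrated_apply, smul_apply,
    CompactlySupportedContinuousMap.coe_smul, Pi.smul_apply, map_smul]
  exact integral_smul c _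

end CovRep

/-- The algebra `C_c(G, A, α)` of continuous compactly supported functions `G → A`: a type synonym
of `C_c(G, A)` that carries the twisted convolution product and the full `L^p` crossed product
seminorm. The seminorm depends on `p`, on `μ` and on the universe `w` of the measure spaces allowed
in covariant representations, so these are recorded in the name of the type; the constant function
in the body does nothing but record `w`. -/
@[nolint unusedArguments]
def ConvAlg (_p : ℝ≥0∞) [MeasurableSpace G] (_μ : Measure G) (_α : IsoAction G A) : Type (max u v) :=
  Function.const (Type w) C_c(G, A) PUnit

namespace ConvAlg

section Add

variable {p} [MeasurableSpace G] {μ : Measure G} {α : IsoAction G A}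

instance : AddCommGroup (ConvAlg.{u, v, w} p μ α) := inferInstanceAs (AddCommGroup C_c(G, A))

instance : Module ℂ (ConvAlg.{u, v, w} p μ α) := inferInstanceAs (Module ℂ C_c(G, A))

/-- The underlying function. -/
def toFn : ConvAlg.{u, v, w} p μ α ≃ₗ[ℂ] C_c(G, A) := LinearEquiv.refl ℂ C_c(G, A)

end Add

variable [IsTopologicalGroup G] [MeasurableSpace G] [BorelSpace G] {μ : Measure G}
  [μ.IsHaarMeasure] (α : IsoAction G A)

section ConvFun

theorem continuous_convKernel (f g : C_c(G, A)) :
    Continuous fun q : G × G => f q.2 * α q.2 (g (q.2⁻¹ * q.1)) := by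
  have h : Continuous fun q : G × G => α q.2 (g (q.2⁻¹ * q.1)) :=
    α.joint.comp (continuous_snd.prodMk (g.continuous.comp (by fun_prop)))
  exact (f.continuous.comp continuous_snd).mul h

theorem hasCompactSupport_convKernel (f g : C_c(G, A)) :
    HasCompactSupport fun q : G × G => f q.2 * α q.2 (g (q.2⁻¹ * q.1)) := by
  refine hasCompactSupport_of_convolution f g ?_
  rintro s r (h | h) <;> simp [h]

variable (μ) in
/-- The twisted convolution `(f * g)(t) = ∫ f(s) α_s(g(s⁻¹ t)) dμ(s)`. -/
def conv (f g : C_c(G, A)) : C_c(G, A) where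
  toFun t := ∫ s, f s * α s (g (s⁻¹ * t)) ∂μ
  continuous_toFun := by
    rw [← continuousOn_univ]
    refine continuousOn_integral_of_compact_support f.hasCompactSupport.isCompact
      (continuous_convKernel α f g).continuousOn fun t s _ hs => ?_
    rw [image_eq_zero_of_notMem_tsupport hs, zero_mul]
  hasCompactSupport' := by
    refine HasCompactSupport.intro
      ((hasCompactSupport_convKernel α f g).isCompact.image continuous_fst) fun t ht => ?_
    rw [← integral_zero G A (μ := μ)]
    congr 1
    ext s
    by_contra hne
    exact ht ⟨(t, s), subset_tsupport _ hne, rfl⟩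

theorem conv_apply (f g : C_c(G, A)) (t : G) :
    conv μ α f g t = ∫ s, f s * α s (g (s⁻¹ * t)) ∂μ := rfl

theorem integrable_convKernel (f g : C_c(G, A)) (t : G) :
    Integrable (fun s => f s * α s (g (s⁻¹ * t))) μ := by
  refine ((continuous_convKernel α f g).comp (by fun_prop : Continuous fun s => (t, s))
    ).integrable_of_hasCompactSupport (HasCompactSupport.intro f.hasCompactSupport.isCompact
      fun s hs => ?_)
  simp [image_eq_zero_of_notMem_tsupport hs]

theorem conv_add (f g h : C_c(G, A)) : conv μ α f (g + h) = conv μ α f g + conv μ α f h := by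
  ext t
  simp only [conv_apply, CompactlySupportedContinuousMap.coe_add, Pi.add_apply, map_add, mul_add]
  exact integral_add (integrable_convKernel α f g t) (integrable_convKernel α f h t)

theorem add_conv (f g h : C_c(G, A)) : conv μ α (f + g) h = conv μ α f h + conv μ α g h := by
  ext t
  simp only [conv_apply, CompactlySupportedContinuousMap.coe_add, Pi.add_apply, add_mul]
  exact integral_add (integrable_convKernel α f h t) (integrable_convKernel α g h t)

variable [IsScalarTower ℂ A A] [SMulCommClass ℂ A A]

theorem smul_conv (c : ℂ) (f g : C_c(G, A)) : conv μ α (c • f) g = c • conv μ α f g := by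
  ext t
  simp only [conv_apply, CompactlySupportedContinuousMap.coe_smul, Pi.smul_apply, smul_mul_assoc]
  exact integral_smul c _

theorem conv_smul (c : ℂ) (f g : C_c(G, A)) : conv μ α f (c • g) = c • conv μ α f g := by
  ext t
  simp only [conv_apply, CompactlySupportedContinuousMap.coe_smul, Pi.smul_apply, map_smul,
    mul_smul_comm]
  exact integral_smul c _

variable [CompleteSpace A]

theorem conv_assoc (f g h : C_c(G, A)) :
    conv μ α (conv μ α f g) h = conv μ α f (conv μ α g h) := by
  ext t
  have h1 : ∀ s, conv μ α f g s * α s (h (s⁻¹ * t)) =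
      ∫ r, f r * α r (g (r⁻¹ * s)) * α s (h (s⁻¹ * t)) ∂μ := fun s =>
    ((((ContinuousLinearMap.mul ℂ A).flip (α s (h (s⁻¹ * t)))).integral_comp_comm
      (integrable_convKernel (μ := μ) α f g s))).symm
  have h2 : ∀ r, f r * α r (conv μ α g h (r⁻¹ * t)) =
      ∫ s, f r * α r (g s * α s (h (s⁻¹ * (r⁻¹ * t)))) ∂μ := fun r =>
    (((ContinuousLinearMap.mul ℂ A (f r)).comp
      (α r).toContinuousLinearEquiv.toContinuousLinearMap).integral_comp_comm
      (integrable_convKernel (μ := μ) α g h (r⁻¹ * t))).symm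
  rw [conv_apply, conv_apply]
  simp only [h1, h2]
  rw [integral_integral_swap_of_hasCompactSupport]
  · refine integral_congr_ae (Filter.Eventually.of_forall fun r => ?_)
    simp only
    rw [← integral_mul_left_eq_self _ r]
    refine integral_congr_ae (Filter.Eventually.of_forall fun s => ?_)
    simp only [inv_mul_cancel_left, α.map_mul', α.apply_mul, mul_inv_rev, mul_assoc]
  · have h3 : Continuous fun q : G × G => α q.1 (h (q.1⁻¹ * t)) :=
      α.joint.comp (continuous_fst.prodMk (h.continuous.comp (by fun_prop)))
    exact (continuous_convKernel α f g).mul h3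
  · refine hasCompactSupport_of_convolution f g ?_
    rintro s r (h | h) <;> simp [h]

theorem integrated_conv {α : IsoAction G A} (ρ : CovRep.{u, v, w} p α) (f g : C_c(G, A)) :
    ρ.integrated μ (conv μ α f g) = ρ.integrated μ f * ρ.integrated μ g := by
  ext1 ξ
  have h1 : ∀ t, ρ.π (conv μ α f g t) (ρ.V t ξ) =
      ∫ s, ρ.π (f s * α s (g (s⁻¹ * t))) (ρ.V t ξ) ∂μ := fun t =>
    ((((ContinuousLinearMap.apply ℂ ρ.E (ρ.V t ξ)).comp ρ.πL).integral_comp_comm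
      (integrable_convKernel (μ := μ) α f g t))).symm
  have h2 : ∀ s, ρ.π (f s) (ρ.V s (ρ.integrated μ g ξ)) =
      ∫ t, ρ.π (f s) (ρ.V s (ρ.π (g t) (ρ.V t ξ))) ∂μ := fun s =>
    (((ρ.π (f s)).comp
      (ρ.V s).toContinuousLinearEquiv.toContinuousLinearMap).integral_comp_comm
      (ρ.integrable_integrand μ g ξ)).symm
  change _ = ρ.integrated μ f (ρ.integrated μ g ξ)
  rw [ρ.integrated_apply, ρ.integrated_apply μ f]
  simp only [h1, h2]
  rw [integral_integral_swap_of_hasCompactSupport]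
  · refine integral_congr_ae (Filter.Eventually.of_forall fun s => ?_)
    simp only
    rw [← integral_mul_left_eq_self _ s]
    refine integral_congr_ae (Filter.Eventually.of_forall fun t => ?_)
    simp only [inv_mul_cancel_left, ρ.V_π, map_mul]
    rfl
  · exact ρ.continuous_integrand (continuous_convKernel α f g) continuous_fst continuous_const
  · refine hasCompactSupport_of_convolution f g ?_
    rintro s r (h | h) <;> simp [h]

end ConvFun

/-! The seminorm and the ring structure. -/

section Ring

variable {p} {α}

theorem bddAbove_integrated (f : ConvAlg.{u, v, w} p μ α) :
    BddAbove (Set.range fun ρ : CovRep.{u, v, w} p α => ‖ρ.integrated μ (toFn f)‖) :=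
  ⟨∫ t, ‖toFn f t‖ ∂μ, by rintro _ ⟨ρ, rfl⟩; exact ρ.norm_integrated_le μ _⟩

variable (p μ α) in
/-- The full `L^p` crossed product seminorm: the supremum of `‖(π ⋊ V)(f)‖` over all
nondegenerate `σ`-finite contractive covariant representations `(π, V)` on `L^p` spaces. -/
def seminorm : Seminorm ℂ (ConvAlg.{u, v, w} p μ α) :=
  Seminorm.of (fun f => ⨆ ρ : CovRep.{u, v, w} p α, ‖ρ.integrated μ (toFn f)‖)
    (fun f g => by
      refine Real.iSup_le (fun ρ => ?_) (add_nonneg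
        (Real.iSup_nonneg fun _ => norm_nonneg _) (Real.iSup_nonneg fun _ => norm_nonneg _))
      rw [map_add, ρ.integrated_add]
      exact (norm_add_le _ _).trans
        (add_le_add (le_ciSup (bddAbove_integrated f) ρ) (le_ciSup (bddAbove_integrated g) ρ)))
    (fun c f => by
      rw [Real.mul_iSup_of_nonneg (norm_nonneg c)]
      simp only [map_smul, CovRep.integrated_smul, norm_smul])

instance : SeminormedAddCommGroup (ConvAlg.{u, v, w} p μ α) :=
  (seminorm p μ α).toAddGroupSeminorm.toSeminormedAddCommGroup

theorem norm_def (f : ConvAlg.{u, v, w} p μ α) :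
    ‖f‖ = ⨆ ρ : CovRep.{u, v, w} p α, ‖ρ.integrated μ (toFn f)‖ := rfl

instance : NormedSpace ℂ (ConvAlg.{u, v, w} p μ α) where
  norm_smul_le c f := (map_smul_eq_mul (seminorm p μ α) c f).le

theorem norm_integrated_le_norm (ρ : CovRep.{u, v, w} p α) (f : ConvAlg.{u, v, w} p μ α) :
    ‖ρ.integrated μ (toFn f)‖ ≤ ‖f‖ :=
  le_ciSup (bddAbove_integrated f) ρ

theorem norm_le_integral (f : ConvAlg.{u, v, w} p μ α) : ‖f‖ ≤ ∫ t, ‖toFn f t‖ ∂μ :=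
  Real.iSup_le (fun ρ => ρ.norm_integrated_le μ _) (integral_nonneg fun _ => norm_nonneg _)

variable [IsScalarTower ℂ A A] [SMulCommClass ℂ A A] [CompleteSpace A]

instance : Mul (ConvAlg.{u, v, w} p μ α) := ⟨fun f g => toFn.symm (conv μ α (toFn f) (toFn g))⟩

theorem toFn_mul (f g : ConvAlg.{u, v, w} p μ α) : toFn (f * g) = conv μ α (toFn f) (toFn g) := rfl

instance : NonUnitalSeminormedRing (ConvAlg.{u, v, w} p μ α) :=
  { (inferInstance : SeminormedAddCommGroup (ConvAlg.{u, v, w} p μ α)) with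
    mul := (· * ·)
    zero_mul := fun a => toFn.injective <| by
      have := smul_conv (μ := μ) α 0 0 (toFn a)
      rwa [zero_smul, zero_smul] at this
    mul_zero := fun a => toFn.injective <| by
      have := conv_smul (μ := μ) α 0 (toFn a) 0
      rwa [zero_smul, zero_smul] at this
    mul_assoc := fun a b c => toFn.injective (conv_assoc α _ _ _)
    left_distrib := fun a b c => toFn.injective (conv_add α _ _ _)
    right_distrib := fun a b c => toFn.injective (add_conv α _ _ _)
    norm_mul_le := fun a b => by
      refine Real.iSup_le (fun ρ => ?_) (mul_nonneg (norm_nonneg a) (norm_nonneg b))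
      rw [toFn_mul, integrated_conv]
      exact (norm_mul_le _ _).trans (mul_le_mul (norm_integrated_le_norm ρ a)
        (norm_integrated_le_norm ρ b) (norm_nonneg _) (norm_nonneg a)) }

theorem smul_mul_eq (c : ℂ) (f g : ConvAlg.{u, v, w} p μ α) : c • f * g = c • (f * g) :=
  toFn.injective (smul_conv α _ _ _)

theorem mul_smul_eq (c : ℂ) (f g : ConvAlg.{u, v, w} p μ α) : f * c • g = c • (f * g) :=
  toFn.injective (conv_smul α _ _ _)

end Ring
end ConvAlg

/-! ### The full `L^p` operator crossed product -/

section Crossed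

variable [IsTopologicalGroup G] [MeasurableSpace G] [BorelSpace G] (μ : Measure G)
  [μ.IsHaarMeasure] (α : IsoAction G A)

/-- The full `L^p` operator crossed product `F^p(G, A, α)`: the completion of `C_c(G, A, α)`. -/
def LpCrossedProduct : Type (max u v) := Completion (ConvAlg.{u, v, w} p μ α)

namespace LpCrossedProduct

instance : NormedAddCommGroup (LpCrossedProduct.{u, v, w} p μ α) :=
  inferInstanceAs (NormedAddCommGroup (Completion (ConvAlg.{u, v, w} p μ α)))

instance : NormedSpace ℂ (LpCrossedProduct.{u, v, w} p μ α) :=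
  inferInstanceAs (NormedSpace ℂ (Completion (ConvAlg.{u, v, w} p μ α)))

instance : CompleteSpace (LpCrossedProduct.{u, v, w} p μ α) :=
  inferInstanceAs (CompleteSpace (Completion (ConvAlg.{u, v, w} p μ α)))

/-- The canonical map from `C_c(G, A, α)` to `F^p(G, A, α)`. -/
def ofConv : ConvAlg.{u, v, w} p μ α →ₗᵢ[ℂ] LpCrossedProduct.{u, v, w} p μ α :=
  Completion.toComplₗᵢ

theorem denseRange_ofConv : DenseRange (ofConv.{u, v, w} p μ α) :=
  Completion.denseRange_coe

/-- The element of `F^p(G, A, α)` given by a continuous compactly supported function. -/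
def ofFn (f : C_c(G, A)) : LpCrossedProduct.{u, v, w} p μ α :=
  ofConv p μ α (ConvAlg.toFn.symm f)

variable [IsScalarTower ℂ A A] [SMulCommClass ℂ A A] [CompleteSpace A]

instance : NonUnitalNormedRing (LpCrossedProduct.{u, v, w} p μ α) :=
  { (inferInstance : NormedAddCommGroup (LpCrossedProduct.{u, v, w} p μ α)) with
    mul := completionMul (ConvAlg.{u, v, w} p μ α)
    zero_mul := zero_completionMul
    mul_zero := completionMul_zero
    mul_assoc := completionMul_assoc
    left_distrib := completionMul_add
    right_distrib := add_completionMul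
    norm_mul_le := norm_completionMul_le }

variable {p μ α} in
theorem ofConv_mul (f g : ConvAlg.{u, v, w} p μ α) :
    ofConv p μ α (f * g) = ofConv p μ α f * ofConv p μ α g :=
  (completionMul_coe f g).symm

variable {p μ α} in
theorem smul_mul_aux (c : ℂ) (x y : LpCrossedProduct.{u, v, w} p μ α) :
    c • x * y = c • (x * y) := by
  have h1 : Continuous fun q : LpCrossedProduct.{u, v, w} p μ α × LpCrossedProduct.{u, v, w} p μ α
      => c • q.1 * q.2 := (continuous_fst.const_smul c).mul continuous_snd
  have h2 : Continuous fun q : LpCrossedProduct.{u, v, w} p μ α × LpCrossedProduct.{u, v, w} p μ α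
      => c • (q.1 * q.2) := (continuous_fst.mul continuous_snd).const_smul c
  refine (denseRange_ofConv p μ α).induction_on₂ (isClosed_eq h1 h2) (fun f g => ?_) x y
  rw [← map_smul, ← ofConv_mul, ← ofConv_mul, ← map_smul, ConvAlg.smul_mul_eq]

variable {p μ α} in
theorem mul_smul_aux (c : ℂ) (x y : LpCrossedProduct.{u, v, w} p μ α) :
    x * c • y = c • (x * y) := by
  have h1 : Continuous fun q : LpCrossedProduct.{u, v, w} p μ α × LpCrossedProduct.{u, v, w} p μ α
      => q.1 * c • q.2 := continuous_fst.mul (continuous_snd.const_smul c)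
  have h2 : Continuous fun q : LpCrossedProduct.{u, v, w} p μ α × LpCrossedProduct.{u, v, w} p μ α
      => c • (q.1 * q.2) := (continuous_fst.mul continuous_snd).const_smul c
  refine (denseRange_ofConv p μ α).induction_on₂ (isClosed_eq h1 h2) (fun f g => ?_) x y
  rw [← map_smul, ← ofConv_mul, ← ofConv_mul, ← map_smul, ConvAlg.mul_smul_eq]

instance : IsScalarTower ℂ (LpCrossedProduct.{u, v, w} p μ α)
    (LpCrossedProduct.{u, v, w} p μ α) := ⟨smul_mul_aux⟩

instance : SMulCommClass ℂ (LpCrossedProduct.{u, v, w} p μ α)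
    (LpCrossedProduct.{u, v, w} p μ α) := ⟨fun c x y => (mul_smul_aux c x y).symm⟩

end LpCrossedProduct

end Crossed

/-! ### Twisting by characters and commuting automorphisms -/

section Twist

theorem continuous_circle_coe : Continuous fun z : Circle => (z : ℂ) := by
  fun_prop

/-- `s ↦ χ(s) θ(f(s))`. -/
def twistFn (χ : PontryaginDual G) (θ : A ≃ₗᵢ[ℂ] A) : C_c(G, A) →ₗ[ℂ] C_c(G, A) where
  toFun f :=
    { toFun := fun s => (χ s : ℂ) • θ (f s)
      continuous_toFun :=
        (continuous_circle_coe.comp (map_continuous χ)).smul (θ.continuous.comp f.continuous)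
      hasCompactSupport' := f.hasCompactSupport.mono fun s hs => by
        contrapose! hs
        simp only [Function.mem_support, not_not] at hs ⊢
        simp [hs] }
  map_add' f g := by
    ext s
    simp
  map_smul' c f := by
    ext s
    simp [smul_comm c]

theorem twistFn_apply (χ : PontryaginDual G) (θ : A ≃ₗᵢ[ℂ] A) (f : C_c(G, A)) (s : G) :
    twistFn χ θ f s = (χ s : ℂ) • θ (f s) := rfl

theorem twistFn_one (f : C_c(G, A)) : twistFn (1 : PontryaginDual G) 1 f = f := by
  ext s
  simp [twistFn_apply]

theorem twistFn_mul (χ χ' : PontryaginDual G) (θ θ' : A ≃ₗᵢ[ℂ] A) (f : C_c(G, A)) :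
    twistFn (χ * χ') (θ * θ') f = twistFn χ θ (twistFn χ' θ' f) := by
  ext s
  have : (χ * χ') s = χ s * χ' s := rfl
  simp [twistFn_apply, this, mul_smul]

/-- Multiplication by a complex number of modulus one as a linear isometry. -/
def circleSMul {E : Type*} [NormedAddCommGroup E] [NormedSpace ℂ E] :
    Circle →* (E ≃ₗᵢ[ℂ] E) where
  toFun z :=
    { LinearEquiv.smulOfNeZero ℂ E (z : ℂ) z.coe_ne_zero with
      norm_map' := fun x => by
        change ‖(z : ℂ) • x‖ = ‖x‖
        rw [norm_smul, Circle.norm_coe, one_mul] }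
  map_one' := by
    ext x
    change ((1 : Circle) : ℂ) • x = x
    simp
  map_mul' z z' := by
    ext x
    change ((z * z' : Circle) : ℂ) • x = (z : ℂ) • (z' : ℂ) • x
    rw [Circle.coe_mul, mul_smul]

theorem circleSMul_apply {E : Type*} [NormedAddCommGroup E] [NormedSpace ℂ E] (z : Circle)
    (x : E) : circleSMul z x = (z : ℂ) • x := rfl

variable {p} {α : IsoAction G A}

/-- The covariant representation `(π ∘ θ, χ V)`. -/
def CovRep.twist (ρ : CovRep.{u, v, w} p α) (χ : PontryaginDual G) (θ : A ≃ₗᵢ[ℂ] A)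
    (hmul : ∀ a b, θ (a * b) = θ a * θ b) (hθ : ∀ g a, θ (α g a) = α g (θ a)) :
    CovRep.{u, v, w} p α where
  X := ρ.X
  ν := ρ.ν
  π :=
    { toFun := fun a => ρ.π (θ a)
      map_smul' := fun c a => by simp
      map_zero' := by simp
      map_add' := fun a b => by simp
      map_mul' := fun a b => by simp [hmul] }
  contractive a := (ρ.contractive (θ a)).trans_eq (θ.norm_map a)
  nondegenerate := by
    rw [← ρ.nondegenerate]
    congr 2
    ext η
    constructor
    · rintro ⟨a, ξ, rfl⟩
      exact ⟨θ a, ξ, rfl⟩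
    · rintro ⟨a, ξ, rfl⟩
      exact ⟨θ.symm a, ξ, by simp⟩
  V :=
    { toFun := fun t => circleSMul (χ t) * ρ.V t
      map_one' := by simp
      map_mul' := fun s t => by
        ext1 ξ
        simp only [map_mul, LinearIsometryEquiv.coe_mul, Function.comp_apply, circleSMul_apply,
          map_smul] }
  continuous_V ξ :=
    (continuous_circle_coe.comp (map_continuous χ)).smul (ρ.continuous_V ξ)
  covariant t a ξ := by
    change (χ t : ℂ) • ρ.V t (ρ.π (θ a) ((χ t⁻¹ : ℂ) • ρ.V t⁻¹ ξ)) = ρ.π (θ (α t a)) ξ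
    rw [map_smul, map_smul, ρ.covariant, ← mul_smul, hθ, ← Circle.coe_mul, ← map_mul,
      mul_inv_cancel, map_one, Circle.coe_one, one_smul]

variable [IsTopologicalGroup G] [MeasurableSpace G] [BorelSpace G] {μ : Measure G}
  [μ.IsHaarMeasure]

theorem CovRep.integrated_twist (ρ : CovRep.{u, v, w} p α) (χ : PontryaginDual G)
    (θ : A ≃ₗᵢ[ℂ] A) (hmul : ∀ a b, θ (a * b) = θ a * θ b)
    (hθ : ∀ g a, θ (α g a) = α g (θ a)) (f : C_c(G, A)) :
    ρ.integrated μ (twistFn χ θ f) = (ρ.twist χ θ hmul hθ).integrated μ f := by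
  ext1 ξ
  change ∫ t, ρ.π ((χ t : ℂ) • θ (f t)) (ρ.V t ξ) ∂μ =
    ∫ t, ρ.π (θ (f t)) ((χ t : ℂ) • ρ.V t ξ) ∂μ
  simp only [map_smul, smul_apply]

/-- The twisting map on the convolution algebra. -/
def twistConv (χ : PontryaginDual G) (θ : A ≃ₗᵢ[ℂ] A) :
    ConvAlg.{u, v, w} p μ α ≃ₗ[ℂ] ConvAlg.{u, v, w} p μ α :=
  { (twistFn χ θ : C_c(G, A) →ₗ[ℂ] C_c(G, A)) with
    invFun := fun f => twistFn χ⁻¹ θ⁻¹ f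
    left_inv := fun f => (twistFn_mul _ _ _ _ f).symm.trans (by
      rw [inv_mul_cancel, inv_mul_cancel]
      exact twistFn_one f)
    right_inv := fun f => (twistFn_mul _ _ _ _ f).symm.trans (by
      rw [mul_inv_cancel, mul_inv_cancel]
      exact twistFn_one f) }

theorem toFn_twistConv (χ : PontryaginDual G) (θ : A ≃ₗᵢ[ℂ] A) (f : ConvAlg.{u, v, w} p μ α) :
    ConvAlg.toFn (twistConv χ θ f) = twistFn χ θ (ConvAlg.toFn f) := rfl

theorem norm_twistConv_le (χ : PontryaginDual G) (θ : A ≃ₗᵢ[ℂ] A)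
    (hmul : ∀ a b, θ (a * b) = θ a * θ b) (hθ : ∀ g a, θ (α g a) = α g (θ a))
    (f : ConvAlg.{u, v, w} p μ α) : ‖twistConv χ θ f‖ ≤ ‖f‖ := by
  refine Real.iSup_le (fun ρ => ?_) (norm_nonneg f)
  change ‖ρ.integrated μ (twistFn χ θ (ConvAlg.toFn f))‖ ≤ _
  rw [ρ.integrated_twist χ θ hmul hθ]
  exact ConvAlg.norm_integrated_le_norm _ f

theorem norm_twistConv (χ : PontryaginDual G) (θ : A ≃ₗᵢ[ℂ] A)
    (hmul : ∀ a b, θ (a * b) = θ a * θ b) (hθ : ∀ g a, θ (α g a) = α g (θ a))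
    (f : ConvAlg.{u, v, w} p μ α) : ‖twistConv χ θ f‖ = ‖f‖ := by
  refine le_antisymm (norm_twistConv_le χ θ hmul hθ f) ?_
  have h := norm_twistConv_le χ⁻¹ θ⁻¹ (α := α) (μ := μ) (p := p)
    (fun a b => θ.injective (by
      rw [hmul]
      change θ (θ.symm _) = θ (θ.symm _) * θ (θ.symm _)
      simp only [LinearIsometryEquiv.apply_symm_apply]))
    (fun g a => θ.injective (by
      rw [hθ]
      change θ (θ.symm _) = α g (θ (θ.symm _))
      simp only [LinearIsometryEquiv.apply_symm_apply])) (twistConv χ θ f)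
  exact (congrArg norm ((twistConv χ θ).symm_apply_apply f)).symm.le.trans h

theorem twistConv_mul_apply [IsScalarTower ℂ A A] [SMulCommClass ℂ A A] [CompleteSpace A]
    (χ : PontryaginDual G) (θ : A ≃ₗᵢ[ℂ] A)
    (hmul : ∀ a b, θ (a * b) = θ a * θ b) (hθ : ∀ g a, θ (α g a) = α g (θ a))
    (f g : ConvAlg.{u, v, w} p μ α) :
    twistConv χ θ (f * g) = twistConv χ θ f * twistConv χ θ g := by
  apply ConvAlg.toFn.injective
  ext t
  change (χ t : ℂ) • θ (∫ s, ConvAlg.toFn f s * α s (ConvAlg.toFn g (s⁻¹ * t)) ∂μ) =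
    ∫ s, ((χ s : ℂ) • θ (ConvAlg.toFn f s)) *
      α s ((χ (s⁻¹ * t) : ℂ) • θ (ConvAlg.toFn g (s⁻¹ * t))) ∂μ
  rw [← LinearIsometryEquiv.coe_toContinuousLinearEquiv, ← ContinuousLinearEquiv.integral_comp_comm,
    ← integral_smul]
  refine integral_congr_ae (Filter.Eventually.of_forall fun s => ?_)
  have h : (χ t : ℂ) = (χ s : ℂ) * (χ (s⁻¹ * t) : ℂ) := by
    rw [← Circle.coe_mul, ← map_mul, mul_inv_cancel_left]
  simp only [LinearIsometryEquiv.coe_toContinuousLinearEquiv, hmul, hθ, map_smul, h,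
    smul_mul_assoc, mul_smul_comm, mul_smul]
  exact smul_comm _ _ _

variable (p μ) in
/-- The extension of a twisting map to the crossed product. -/
def twistIso (χ : PontryaginDual G) (θ : A ≃ₗᵢ[ℂ] A)
    (hmul : ∀ a b, θ (a * b) = θ a * θ b) (hθ : ∀ g a, θ (α g a) = α g (θ a)) :
    LpCrossedProduct.{u, v, w} p μ α ≃ₗᵢ[ℂ] LpCrossedProduct.{u, v, w} p μ α :=
  LinearEquiv.extendOfIsometry (twistConv χ θ)
    (LpCrossedProduct.ofConv.{u, v, w} p μ α).toLinearMap
    (LpCrossedProduct.ofConv.{u, v, w} p μ α).toLinearMap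
    (LpCrossedProduct.denseRange_ofConv p μ α) (LpCrossedProduct.denseRange_ofConv p μ α)
    (fun f => by
      simp only [LinearIsometry.coe_toLinearMap, LinearIsometry.norm_map]
      exact norm_twistConv χ θ hmul hθ f)

theorem twistIso_ofConv (χ : PontryaginDual G) (θ : A ≃ₗᵢ[ℂ] A)
    (hmul : ∀ a b, θ (a * b) = θ a * θ b) (hθ : ∀ g a, θ (α g a) = α g (θ a))
    (f : ConvAlg.{u, v, w} p μ α) :
    twistIso p μ χ θ hmul hθ (LpCrossedProduct.ofConv p μ α f) =
      LpCrossedProduct.ofConv p μ α (twistConv χ θ f) :=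
  LinearEquiv.extendOfIsometry_eq _ (LpCrossedProduct.ofConv.{u, v, w} p μ α).toLinearMap
    (LpCrossedProduct.ofConv.{u, v, w} p μ α).toLinearMap _ _ _ f

variable [IsScalarTower ℂ A A] [SMulCommClass ℂ A A] [CompleteSpace A]
  {H : Type*} [Group H] [TopologicalSpace H]

theorem continuous_twistConv (θ : IsoAction H A) (χ : H →* PontryaginDual G)
    (hχ : Continuous fun q : H × G => χ q.1 q.2) (f : ConvAlg.{u, v, w} p μ α) :
    Continuous fun h => twistConv (χ h) (θ h) f := by
  rw [continuous_iff_continuousAt]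
  intro h₀
  rw [ContinuousAt, tendsto_iff_norm_sub_tendsto_zero]
  have h1 : Continuous fun q : H × G => twistFn (χ q.1) (θ q.1) (ConvAlg.toFn f) q.2 :=
    (continuous_circle_coe.comp hχ).smul
      (θ.joint.comp (continuous_fst.prodMk ((ConvAlg.toFn f).continuous.comp continuous_snd)))
  have h2 : Continuous fun h => ∫ s, ‖twistFn (χ h) (θ h) (ConvAlg.toFn f) s -
      twistFn (χ h₀) (θ h₀) (ConvAlg.toFn f) s‖ ∂μ := by
    rw [← continuousOn_univ]
    refine continuousOn_integral_of_compact_support (ConvAlg.toFn f).hasCompactSupport.isCompact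
      (h1.sub (h1.comp (continuous_const.prodMk continuous_snd))).norm.continuousOn
      fun h s _ hs => ?_
    simp [twistFn_apply, image_eq_zero_of_notMem_tsupport hs]
  have h3 := h2.tendsto h₀
  simp only [sub_self, norm_zero, integral_zero] at h3
  exact squeeze_zero (fun _ => norm_nonneg _) (fun h => ConvAlg.norm_le_integral _) h3

theorem twistIso_one {χ : PontryaginDual G} {θ : A ≃ₗᵢ[ℂ] A}
    (hmul : ∀ a b, θ (a * b) = θ a * θ b) (hθ : ∀ g a, θ (α g a) = α g (θ a))
    (h1 : χ = 1) (h2 : θ = 1) (x : LpCrossedProduct.{u, v, w} p μ α) :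
    twistIso p μ χ θ hmul hθ x = x := by
  refine (LpCrossedProduct.denseRange_ofConv p μ α).induction_on x
    (isClosed_eq (LinearIsometryEquiv.continuous _) continuous_id) fun f => ?_
  rw [twistIso_ofConv]
  refine congrArg (LpCrossedProduct.ofConv p μ α) (ConvAlg.toFn.injective ?_)
  rw [toFn_twistConv, h1, h2, twistFn_one]

theorem twistIso_comp {χ χ' χ'' : PontryaginDual G} {θ θ' θ'' : A ≃ₗᵢ[ℂ] A}
    (hmul : ∀ a b, θ (a * b) = θ a * θ b) (hθ : ∀ g a, θ (α g a) = α g (θ a))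
    (hmul' : ∀ a b, θ' (a * b) = θ' a * θ' b) (hθ' : ∀ g a, θ' (α g a) = α g (θ' a))
    (hmul'' : ∀ a b, θ'' (a * b) = θ'' a * θ'' b) (hθ'' : ∀ g a, θ'' (α g a) = α g (θ'' a))
    (h1 : χ'' = χ * χ') (h2 : θ'' = θ * θ') (x : LpCrossedProduct.{u, v, w} p μ α) :
    twistIso p μ χ'' θ'' hmul'' hθ'' x =
      twistIso p μ χ θ hmul hθ (twistIso p μ χ' θ' hmul' hθ' x) := by
  refine (LpCrossedProduct.denseRange_ofConv p μ α).induction_on x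
    (isClosed_eq (LinearIsometryEquiv.continuous _) ((LinearIsometryEquiv.continuous _).comp
      (LinearIsometryEquiv.continuous _))) fun f => ?_
  rw [twistIso_ofConv, twistIso_ofConv, twistIso_ofConv]
  refine congrArg (LpCrossedProduct.ofConv p μ α) (ConvAlg.toFn.injective ?_)
  rw [toFn_twistConv, toFn_twistConv, toFn_twistConv, h1, h2, twistFn_mul]

theorem twistIso_mul (χ : PontryaginDual G) (θ : A ≃ₗᵢ[ℂ] A)
    (hmul : ∀ a b, θ (a * b) = θ a * θ b) (hθ : ∀ g a, θ (α g a) = α g (θ a))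
    (x y : LpCrossedProduct.{u, v, w} p μ α) :
    twistIso p μ χ θ hmul hθ (x * y) =
      twistIso p μ χ θ hmul hθ x * twistIso p μ χ θ hmul hθ y := by
  have hc := (twistIso (α := α) p μ χ θ hmul hθ).continuous
  refine (LpCrossedProduct.denseRange_ofConv p μ α).induction_on₂
    (isClosed_eq (hc.comp (continuous_fst.mul continuous_snd))
      ((hc.comp continuous_fst).mul (hc.comp continuous_snd))) (fun f g => ?_) x y
  rw [← LpCrossedProduct.ofConv_mul, twistIso_ofConv, twistIso_ofConv, twistIso_ofConv,
    ← LpCrossedProduct.ofConv_mul, twistConv_mul_apply _ _ hmul hθ]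

theorem continuous_twistIso (θ : IsoAction H A) (hθ : ∀ h g a, θ h (α g a) = α g (θ h a))
    (χ : H →* PontryaginDual G) (hχ : Continuous fun q : H × G => χ q.1 q.2)
    (x : LpCrossedProduct.{u, v, w} p μ α) :
    Continuous fun h => twistIso p μ (χ h) (θ h) (θ.map_mul' h) (hθ h) x := by
  rw [Metric.continuous_iff']
  intro h₀ ε hε
  obtain ⟨f, hf⟩ := (LpCrossedProduct.denseRange_ofConv p μ α).exists_dist_lt x
    (ε := ε / 3) (by positivity)
  have hc : Continuous fun h => LpCrossedProduct.ofConv p μ α (twistConv (χ h) (θ h) f) :=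
    (LpCrossedProduct.ofConv p μ α).continuous.comp (continuous_twistConv θ χ hχ f)
  filter_upwards [Metric.continuous_iff'.1 hc h₀ (ε / 3) (by positivity)] with h hh
  rw [← twistIso_ofConv _ _ (θ.map_mul' h) (hθ h),
    ← twistIso_ofConv _ _ (θ.map_mul' h₀) (hθ h₀)] at hh
  refine (dist_triangle4 _
    (twistIso p μ (χ h) (θ h) (θ.map_mul' h) (hθ h) (LpCrossedProduct.ofConv p μ α f))
    (twistIso p μ (χ h₀) (θ h₀) (θ.map_mul' h₀) (hθ h₀) (LpCrossedProduct.ofConv p μ α f))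
    _).trans_lt ?_
  rw [LinearIsometryEquiv.dist_map, LinearIsometryEquiv.dist_map, dist_comm _ x]
  linarith

variable (p μ) in
/-- The action `h ↦ (f ↦ χ_h(·) θ_h(f(·)))` of a group `H` on `F^p(G, A, α)`, for an action `θ` of
`H` on `A` commuting with `α` and a continuous family `χ` of characters of `G`. -/
def twistAction (θ : IsoAction H A) (hθ : ∀ h g a, θ h (α g a) = α g (θ h a))
    (χ : H →* PontryaginDual G) (hχ : Continuous fun q : H × G => χ q.1 q.2) :
    IsoAction H (LpCrossedProduct.{u, v, w} p μ α) where
  toHom :=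
    { toFun := fun h => twistIso p μ (χ h) (θ h) (θ.map_mul' h) (hθ h)
      map_one' := LinearIsometryEquiv.ext fun x =>
        twistIso_one _ _ (map_one χ) (map_one θ.toHom) x
      map_mul' := fun h h' => LinearIsometryEquiv.ext fun x =>
        twistIso_comp _ _ _ _ _ _ (map_mul χ h h') (map_mul θ.toHom h h') x }
  map_mul' h x y := twistIso_mul _ _ (θ.map_mul' h) (hθ h) x y
  continuous' x := continuous_twistIso θ hθ χ hχ x

theorem twistAction_ofFn (θ : IsoAction H A) (hθ : ∀ h g a, θ h (α g a) = α g (θ h a))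
    (χ : H →* PontryaginDual G) (hχ : Continuous fun q : H × G => χ q.1 q.2) (h : H)
    (f : C_c(G, A)) :
    twistAction.{u, v, w} p μ θ hθ χ hχ h (LpCrossedProduct.ofFn p μ α f) =
      LpCrossedProduct.ofFn p μ α (twistFn (χ h) (θ h) f) :=
  twistIso_ofConv _ _ (θ.map_mul' h) (hθ h) _

end Twist

/-! ### Functions of two variables as elements of iterated crossed products -/

section Section

variable [IsTopologicalGroup G] [MeasurableSpace G] [BorelSpace G] (μ : Measure G)
  [μ.IsHaarMeasure] (α : IsoAction G A)
  {K : Type*} [Group K] [TopologicalSpace K] [IsTopologicalGroup K]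

/-- The function `F(k, ·)`. -/
def sectionFn (F : C_c(K × G, A)) (k : K) : C_c(G, A) where
  toFun s := F (k, s)
  continuous_toFun := F.continuous.comp (by fun_prop)
  hasCompactSupport' := HasCompactSupport.intro
    (F.hasCompactSupport.isCompact.image continuous_snd) fun s hs => by
      by_contra h
      exact hs ⟨(k, s), subset_tsupport _ h, rfl⟩

/-- The continuous compactly supported function `k ↦ F(k, ·)` from `K` to `F^p(G, A, α)`. -/
def sectionMap (F : C_c(K × G, A)) : C_c(K, LpCrossedProduct.{u, v, w} p μ α) where
  toFun k := LpCrossedProduct.ofFn p μ α (sectionFn F k)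
  continuous_toFun := by
    rw [continuous_iff_continuousAt]
    intro k₀
    rw [ContinuousAt, tendsto_iff_norm_sub_tendsto_zero]
    have h2 : Continuous fun k => ∫ s, ‖F (k, s) - F (k₀, s)‖ ∂μ := by
      rw [← continuousOn_univ]
      refine continuousOn_integral_of_compact_support
        (F.hasCompactSupport.isCompact.image continuous_snd)
        ((F.continuous.comp (by fun_prop : Continuous fun q : K × G => (q.1, q.2))).sub
          (F.continuous.comp (by fun_prop : Continuous fun q : K × G => (k₀, q.2)))
          ).norm.continuousOn fun k s _ hs => ?_
      have : ∀ k, F (k, s) = 0 := fun k => by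
        by_contra h
        exact hs ⟨(k, s), subset_tsupport _ h, rfl⟩
      simp [this]
    have h3 := h2.tendsto k₀
    simp only [sub_self, norm_zero, integral_zero] at h3
    refine squeeze_zero (fun _ => norm_nonneg _) (fun k => ?_) h3
    rw [LpCrossedProduct.ofFn, LpCrossedProduct.ofFn, ← map_sub, LinearIsometry.norm_map]
    exact ConvAlg.norm_le_integral _
  hasCompactSupport' := HasCompactSupport.intro
    (F.hasCompactSupport.isCompact.image continuous_fst) fun k hk => by
      have : sectionFn F k = 0 := by
        ext s
        by_contra h
        exact hk ⟨(k, s), subset_tsupport _ h, rfl⟩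
      rw [this, LpCrossedProduct.ofFn, map_zero, map_zero]

end Section
end Basic

/-! ### The dual action, the action `β̂ ⊗ α`, and the label change -/

section Dual

variable (p : ℝ≥0∞) [Fact (1 ≤ p)] {G : Type u} [CommGroup G] [TopologicalSpace G]
  [IsTopologicalGroup G] [LocallyCompactSpace G] [MeasurableSpace G]
  {A : Type v} [NonUnitalNormedRing A] [NormedSpace ℂ A] [IsScalarTower ℂ A A]
  [SMulCommClass ℂ A A] [CompleteSpace A]

theorem continuous_dual_apply : Continuous fun q : PontryaginDual G × G => q.1 q.2 :=
  (ContinuousMonoidHom.instContinuousEval (A := G) (B := Circle)).continuous_eval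

variable (G) in
/-- The canonical map of `G` to its double dual, `s ↦ (γ ↦ γ(s))`. -/
def evalHom : G →* PontryaginDual (PontryaginDual G) where
  toFun s :=
    ({ toFun := fun γ => γ s
       map_one' := rfl
       map_mul' := fun _ _ => rfl
       continuous_toFun := continuous_dual_apply.comp (continuous_id.prodMk continuous_const) } :
      PontryaginDual G →ₜ* Circle)
  map_one' := by
    ext γ
    exact congrArg _ (map_one γ)
  map_mul' s t := by
    ext γ
    exact congrArg _ (map_mul γ s t)

theorem evalHom_apply (s : G) (γ : PontryaginDual G) : evalHom G s γ = γ s := rfl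

theorem continuous_inv_apply :
    Continuous fun q : PontryaginDual G × G => (invMonoidHom q.1 : PontryaginDual G) q.2 :=
  (continuous_dual_apply (G := G)).inv

theorem continuous_evalHom_apply :
    Continuous fun q : G × PontryaginDual G => evalHom G q.1 q.2 :=
  (continuous_dual_apply (G := G)).comp continuous_swap

/-- The trivial action commutes with every action. -/
theorem trivial_comm {H K : Type*} [Group H] [TopologicalSpace H] [Group K] [TopologicalSpace K]
    (α : IsoAction K A) (h : H) (k : K) (a : A) :
    IsoAction.trivial H A h (α k a) = α k (IsoAction.trivial H A h a) := rfl

/-- The dual action `α̂` of `Ĝ` on `F^p(G, A, α)`, given by `α̂_γ(f)(s) = conj(γ(s)) f(s)` on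
`C_c(G, A, α)`. -/
def dualAction [BorelSpace G] (μ : Measure G) [μ.IsHaarMeasure] (α : IsoAction G A) :
    IsoAction (PontryaginDual G) (LpCrossedProduct.{u, v, w} p μ α) :=
  twistAction p μ (IsoAction.trivial (PontryaginDual G) A) (trivial_comm α) invMonoidHom
    continuous_inv_apply

theorem dualAction_ofFn [BorelSpace G] (μ : Measure G) [μ.IsHaarMeasure] (α : IsoAction G A)
    (γ : PontryaginDual G) (f g : C_c(G, A)) (h : ∀ s, g s = starRingEnd ℂ (γ s : ℂ) • f s) :
    dualAction.{u, v, w} p μ α γ (LpCrossedProduct.ofFn p μ α f) =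
      LpCrossedProduct.ofFn p μ α g := by
  rw [dualAction, twistAction_ofFn]
  congr 1
  ext s
  rw [h, ← Circle.coe_inv_eq_conj]
  rfl

/-- The action `β̂ ⊗ α` of `G` on `F^p(Ĝ, A, β)`, where `β` is the trivial action of `Ĝ` on `A`,
given by `(β̂ ⊗ α)_s(φ)(γ) = γ(s) α_s(φ(γ))` on `C_c(Ĝ, A, β)`. -/
def dualTensorAction [MeasurableSpace (PontryaginDual G)] [BorelSpace (PontryaginDual G)]
    (m : Measure (PontryaginDual G)) [m.IsHaarMeasure] (α : IsoAction G A) :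
    IsoAction G (LpCrossedProduct.{u, v, w} p m (IsoAction.trivial (PontryaginDual G) A)) :=
  twistAction p m α (fun s γ a => (trivial_comm α γ s a).symm) (evalHom G)
    continuous_evalHom_apply

theorem dualTensorAction_ofFn [MeasurableSpace (PontryaginDual G)]
    [BorelSpace (PontryaginDual G)] (m : Measure (PontryaginDual G)) [m.IsHaarMeasure]
    (α : IsoAction G A) (s : G) (f g : C_c(PontryaginDual G, A))
    (h : ∀ γ, g γ = (γ s : ℂ) • α s (f γ)) :
    dualTensorAction.{u, v, w} p m α s (LpCrossedProduct.ofFn p m _ f) =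
      LpCrossedProduct.ofFn p m _ g := by
  rw [dualTensorAction, twistAction_ofFn]
  congr 1
  ext γ
  rw [h]
  rfl

/-- The label change `Φ₁(F)(s, γ) = γ(s) F(γ, s)`. -/
def labelChange (F : C_c(PontryaginDual G × G, A)) : C_c(G × PontryaginDual G, A) where
  toFun q := (q.2 q.1 : ℂ) • F (q.2, q.1)
  continuous_toFun :=
    (continuous_circle_coe.comp (continuous_dual_apply.comp continuous_swap)).smul
      (F.continuous.comp continuous_swap)
  hasCompactSupport' :=
    (F.hasCompactSupport.comp_homeomorph (Homeomorph.prodComm G (PontryaginDual G))).smul_left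

theorem labelChange_apply (F : C_c(PontryaginDual G × G, A)) (s : G) (γ : PontryaginDual G) :
    labelChange F (s, γ) = (γ s : ℂ) • F (γ, s) := rfl

end Dual

section Discrete

variable {G : Type u} [Group G] [TopologicalSpace G] [DiscreteTopology G] [MeasurableSpace G]
  [BorelSpace G]

instance count_isHaarMeasure : (Measure.count : Measure G).IsHaarMeasure where
  lt_top_of_isCompact K hK := by
    rw [Measure.count_apply_finite K hK.finite_of_discrete]
    exact ENNReal.coe_lt_top
  open_pos U hU hne := by
    rw [Ne, Measure.count_eq_zero_iff]
    exact hne.ne_empty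

end Discrete

/-! ### `L^p` operator algebras and unique `L^p` operator matrix norms -/

section OperatorAlgebra

variable (p : ℝ≥0∞) [Fact (1 ≤ p)] (A : Type v) [NonUnitalNormedRing A] [NormedSpace ℂ A]

/-- `A` has an isometric representation on an `L^p` space. -/
def IsLpOperatorAlgebra : Prop :=
  ∃ (X : Type w) (_ : MeasurableSpace X) (ν : Measure X) (π : A →ₙₐ[ℂ] (Lp ℂ p ν →L[ℂ] Lp ℂ p ν)),
    ∀ a, ‖π a‖ = ‖a‖

variable {p} in
/-- The operator on the `n`-fold `ℓ^p` direct sum `E ⊕ ... ⊕ E` given by an `n × n` matrix of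
operators on `E`. For `E = L^p(X, ν)` this `ℓ^p` direct sum is `L^p({1, ..., n} × X)` with respect
to the product of counting measure and `ν`. -/
def matrixOperator {E : Type*} [NormedAddCommGroup E] [NormedSpace ℂ E] {n : ℕ}
    (T : Matrix (Fin n) (Fin n) (E →L[ℂ] E)) :
    PiLp p (fun _ : Fin n => E) →L[ℂ] PiLp p (fun _ : Fin n => E) :=
  (PiLp.continuousLinearEquiv p ℂ fun _ : Fin n => E).symm.toContinuousLinearMap ∘L
    (ContinuousLinearMap.pi fun i => ∑ j, T i j ∘L ContinuousLinearMap.proj j) ∘L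
    (PiLp.continuousLinearEquiv p ℂ fun _ : Fin n => E).toContinuousLinearMap

/-- `A` has unique `L^p` operator matrix norms: any two isometric representations of `A` on
separable `L^p` spaces of `σ`-finite measures induce the same norm on every matrix algebra
`M_n(A)`. -/
def HasUniqueLpMatrixNorms : Prop :=
  ∀ (X Y : Type w) (_ : MeasurableSpace X) (_ : MeasurableSpace Y) (ν : Measure X) (η : Measure Y),
    SigmaFinite ν → SigmaFinite η →
    TopologicalSpace.SeparableSpace (Lp ℂ p ν) → TopologicalSpace.SeparableSpace (Lp ℂ p η) →
    ∀ (π : A →ₙₐ[ℂ] (Lp ℂ p ν →L[ℂ] Lp ℂ p ν)) (σ : A →ₙₐ[ℂ] (Lp ℂ p η →L[ℂ] Lp ℂ p η)),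
      (∀ a, ‖π a‖ = ‖a‖) → (∀ a, ‖σ a‖ = ‖a‖) →
      ∀ (n : ℕ) (a : Matrix (Fin n) (Fin n) A),
        ‖matrixOperator (p := p) (a.map π)‖ = ‖matrixOperator (p := p) (a.map σ)‖

end OperatorAlgebra

end LpCrossed

end

/-! Both iterated crossed products are governed by the same data on an `L^p` space: a representation
`π` of `A` and isometric representations `V` of `G` and `U` of the dual group, each covariant with
`π`, tied together by `U_γ V_s = conj(γ(s)) V_s U_γ`. Grouping `(π, V)` first gives a covariant
representation for the dual action on `F^p(G, A, α)`. Grouping `(π, U)` first gives one for `β̂ ⊗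
α`. A function `F` acts in the first picture as `∫∫ π(F(γ, s)) V_s U_γ`. In the second picture its
label change carries a factor `γ(s)`, which cancels the scalar in the commutation relation, so it
acts by the same operator.

The crossed product norms are suprema over such representations. The label change is therefore
isometric on functions of two variables, which are dense on both sides (`denseRange_sectionMap`),
and it extends to the completions. Multiplicativity needs no computation with convolutions: every
covariant representation of the first algebra is `σ ∘ Φ` for a homomorphism `σ` on the second, and
these representations separate points.

The analytic core is disintegration: a nondegenerate contractive representation of `F^p(G, A, α)`
must be shown to come from a covariant pair. The elements of `A` and `G` act on the crossed product
as left multipliers (`mulShift`). A contractive approximate identity of the form bump times `1`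
carries multipliers over to the representation space (`exists_extend_multiplier`), and `ofFn_mul`,
which writes `f` as the integral of the multipliers `f(s) u_s`, recovers the original representation
(`integrated_disintegrate`).

The argument is run for two groups `G` and `K` with commuting actions on `A` and a pairing `χ`. This
setting is symmetric, so one norm inequality, applied in both directions, gives equality. -/

noncomputable section

namespace LpCrossed

/-! ### The representation of the crossed product given by a covariant representation -/

section IntegratedHom

variable {p : ℝ≥0∞} [Fact (1 ≤ p)] {G : Type u} [Group G] [TopologicalSpace G]
  [IsTopologicalGroup G] [MeasurableSpace G] [BorelSpace G]
  {A : Type v} [NonUnitalNormedRing A] [NormedSpace ℂ A] [IsScalarTower ℂ A A]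
  [SMulCommClass ℂ A A] [CompleteSpace A]
  {μ : Measure G} [μ.IsHaarMeasure] {α : IsoAction G A}

namespace LpCrossedProduct

variable (p μ α) in
/-- The map `ofFn` as a linear map. -/
def ofFnₗ : C_c(G, A) →ₗ[ℂ] LpCrossedProduct.{u, v, w} p μ α :=
  (ofConv.{u, v, w} p μ α).toLinearMap ∘ₗ ConvAlg.toFn.symm.toLinearMap

@[simp] theorem ofFnₗ_apply (f : C_c(G, A)) :
    ofFnₗ.{u, v, w} p μ α f = ofFn.{u, v, w} p μ α f := rfl

variable (p μ α) in
theorem denseRange_ofFn : DenseRange (ofFn.{u, v, w} p μ α) := by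
  exact (denseRange_ofConv.{u, v, w} p μ α).comp ConvAlg.toFn.symm.surjective.denseRange
    (ofConv.{u, v, w} p μ α).continuous

theorem ofFn_conv (f g : C_c(G, A)) :
    ofFn.{u, v, w} p μ α (ConvAlg.conv μ α f g) = ofFn p μ α f * ofFn p μ α g :=
  ofConv_mul _ _

theorem norm_ofFn_le_integral (f : C_c(G, A)) :
    ‖ofFn.{u, v, w} p μ α f‖ ≤ ∫ t, ‖f t‖ ∂μ := by
  rw [ofFn, LinearIsometry.norm_map]
  exact ConvAlg.norm_le_integral _

end LpCrossedProduct

namespace CovRep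

open LpCrossedProduct

variable (ρ : CovRep.{u, v, w} p α)

variable (μ) in
/-- The integrated form as a linear map. -/
def integratedₗ : ConvAlg.{u, v, w} p μ α →ₗ[ℂ] (ρ.E →L[ℂ] ρ.E) where
  toFun f := ρ.integrated μ (ConvAlg.toFn f)
  map_add' _ _ := ρ.integrated_add μ _ _
  map_smul' c _ := ρ.integrated_smul μ c _

theorem norm_integratedₗ_le (f : ConvAlg.{u, v, w} p μ α) :
    ‖ρ.integratedₗ μ f‖ ≤ 1 * ‖(ofConv.{u, v, w} p μ α).toLinearMap f‖ := by
  rw [one_mul, LinearIsometry.coe_toLinearMap, LinearIsometry.norm_map]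
  exact ConvAlg.norm_integrated_le_norm ρ f

variable (μ) in
/-- The extension of the integrated form to the crossed product, as a bounded linear map. -/
def integratedL : LpCrossedProduct.{u, v, w} p μ α →L[ℂ] (ρ.E →L[ℂ] ρ.E) :=
  LinearMap.extendOfNorm (ρ.integratedₗ μ) (ofConv.{u, v, w} p μ α).toLinearMap

theorem integratedL_ofFn (f : C_c(G, A)) :
    ρ.integratedL μ (ofFn p μ α f) = ρ.integrated μ f :=
  LinearMap.extendOfNorm_eq (e := (ofConv.{u, v, w} p μ α).toLinearMap)
    (denseRange_ofConv p μ α) ⟨1, ρ.norm_integratedₗ_le⟩ (ConvAlg.toFn.symm f)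

theorem norm_integratedL_le (x : LpCrossedProduct.{u, v, w} p μ α) :
    ‖ρ.integratedL μ x‖ ≤ ‖x‖ :=
  (LinearMap.norm_extendOfNorm_apply_le (e := (ofConv.{u, v, w} p μ α).toLinearMap)
    (denseRange_ofConv p μ α) 1 ρ.norm_integratedₗ_le x).trans_eq (one_mul _)

theorem integratedL_mul (x y : LpCrossedProduct.{u, v, w} p μ α) :
    ρ.integratedL μ (x * y) = ρ.integratedL μ x * ρ.integratedL μ y := by
  have hc := (ρ.integratedL μ).continuous
  refine (denseRange_ofFn p μ α).induction_on₂
    (isClosed_eq (hc.comp (continuous_fst.mul continuous_snd))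
      ((hc.comp continuous_fst).mul (hc.comp continuous_snd))) (fun f g => ?_) x y
  rw [← ofFn_conv, integratedL_ofFn, integratedL_ofFn, integratedL_ofFn,
    ConvAlg.integrated_conv]

variable (μ) in
/-- The representation of the crossed product given by a covariant representation. -/
def integratedHom : LpCrossedProduct.{u, v, w} p μ α →ₙₐ[ℂ] (ρ.E →L[ℂ] ρ.E) where
  toFun := ρ.integratedL μ
  map_smul' c x := map_smul (ρ.integratedL μ) c x
  map_zero' := map_zero (ρ.integratedL μ)
  map_add' := map_add (ρ.integratedL μ)
  map_mul' := ρ.integratedL_mul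

end CovRep

namespace LpCrossedProduct

/-- On functions the norm is by definition a supremum over covariant representations. This survives
completion because every integrated form is contractive: approximating `x` by a function costs the
same small error in the norm and in each representation. -/
theorem norm_le_of_forall_integratedL {x : LpCrossedProduct.{u, v, w} p μ α} {C : ℝ}
    (hC : 0 ≤ C) (h : ∀ ρ : CovRep.{u, v, w} p α, ‖ρ.integratedL μ x‖ ≤ C) : ‖x‖ ≤ C := by
  refine le_of_forall_pos_le_add fun ε hε => ?_
  obtain ⟨f, hf⟩ := (denseRange_ofFn p μ α).exists_dist_lt x (ε := ε / 2) (by positivity)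
  rw [dist_eq_norm] at hf
  have h1 : ‖ofFn p μ α f‖ ≤ C + ε / 2 := by
    rw [ofFn, LinearIsometry.norm_map]
    refine Real.iSup_le (fun ρ => ?_) (by positivity)
    have h2 := norm_le_norm_add_norm_sub (ρ.integratedL μ x) (ρ.integratedL μ (ofFn p μ α f))
    rw [← map_sub, ρ.integratedL_ofFn] at h2
    exact h2.trans (add_le_add (h ρ) ((ρ.norm_integratedL_le _).trans hf.le))
  have h3 := norm_le_norm_add_norm_sub (ofFn p μ α f) x
  rw [norm_sub_rev] at h3
  linarith

/-- Integrated forms separate points, so identities in the crossed product reduce to operator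
identities that follow from covariance. -/
theorem ext_integratedL {x y : LpCrossedProduct.{u, v, w} p μ α}
    (h : ∀ ρ : CovRep.{u, v, w} p α, ρ.integratedL μ x = ρ.integratedL μ y) : x = y := by
  rw [← sub_eq_zero, ← norm_le_zero_iff]
  refine norm_le_of_forall_integratedL le_rfl fun ρ => ?_
  rw [map_sub, h, sub_self, norm_zero]

end LpCrossedProduct

end IntegratedHom

/-! ### Nondegenerate representations -/

section Nondegenerate

variable {B : Type*} [NonUnitalNormedRing B] [NormedSpace ℂ B]
  {E : Type*} [NormedAddCommGroup E] [NormedSpace ℂ E]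

/-- Two bounded operators that agree on the essential space of a nondegenerate representation are
equal. -/
theorem eq_of_nondegenerate {F : Type*} [NormedAddCommGroup F] [NormedSpace ℂ F]
    {π : B → E →L[ℂ] E}
    (hπ : (Submodule.span ℂ {η | ∃ b ξ, η = π b ξ}).topologicalClosure = ⊤) {S T : E →L[ℂ] F}
    (h : ∀ b ξ, S (π b ξ) = T (π b ξ)) : S = T := by
  refine ContinuousLinearMap.ext_on
    ((Submodule.dense_iff_topologicalClosure_eq_top).2 hπ) ?_
  rintro _ ⟨b, ξ, rfl⟩
  exact h b ξ

/-- A left multiplier of a Banach algebra with a contractive approximate identity acts on the space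
of every nondegenerate contractive representation. -/
theorem exists_extend_multiplier [CompleteSpace E] [IsScalarTower ℂ B B] [SMulCommClass ℂ B B]
    (π : B →ₙₐ[ℂ] (E →L[ℂ] E)) (hc : ∀ b, ‖π b‖ ≤ ‖b‖)
    (hπ : (Submodule.span ℂ {η | ∃ b ξ, η = π b ξ}).topologicalClosure = ⊤)
    {ι : Type*} {l : Filter ι} [l.NeBot] (e : ι → B) (he1 : ∀ i, ‖e i‖ ≤ 1)
    (he : ∀ b, Filter.Tendsto (fun i => e i * b) l (𝓝 b))
    (L : B →L[ℂ] B) (hL : ∀ b c, L (b * c) = L b * c) {C : ℝ} (hC0 : 0 ≤ C)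
    (hC : ∀ b, ‖L b‖ ≤ C * ‖b‖) :
    ∃ T : E →L[ℂ] E, (∀ b ξ, T (π b ξ) = π (L b) ξ) ∧ ∀ ξ, ‖T ξ‖ ≤ C * ‖ξ‖ := by
  have hpc : Continuous π :=
    AddMonoidHomClass.continuous_of_bound π 1 fun b => (hc b).trans_eq (one_mul _).symm
  -- The operator sought sends `π(b)ξ` to `π(L b)ξ`. A vector may be a sum of such terms in many
  -- ways; the tensor product parametrizes these expressions, and well-definedness becomes a norm
  -- comparison of `m L` with `m id`.
  let m : (B →ₗ[ℂ] B) → (TensorProduct ℂ B E →ₗ[ℂ] E) := fun M => TensorProduct.lift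
    (LinearMap.mk₂ ℂ (fun b ξ => π (M b) ξ) (fun b b' ξ => by simp) (fun c b ξ => by simp)
      (fun b ξ ξ' => by simp) (fun c b ξ => by simp))
  have hm : ∀ M b ξ, m M (b ⊗ₜ ξ) = π (M b) ξ := fun M b ξ => by simp [m]
  have hd : DenseRange (m LinearMap.id) := by
    have h1 : Dense (Submodule.span ℂ {η | ∃ b ξ, η = π b ξ} : Set E) :=
      (Submodule.dense_iff_topologicalClosure_eq_top).2 hπ
    refine h1.mono ?_
    have : Submodule.span ℂ {η | ∃ b ξ, η = π b ξ} ≤ LinearMap.range (m LinearMap.id) := by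
      rw [Submodule.span_le]
      rintro _ ⟨b, ξ, rfl⟩
      exact ⟨b ⊗ₜ ξ, by rw [hm]; rfl⟩
    exact this
  -- Since `L(e_i) b = L(e_i b)` tends to `L b`, the operators `π(L(e_i))`, which are defined on all
  -- of `E`, converge on the essential space to the operator sought.
  have ht : ∀ z, Filter.Tendsto (fun i => π (L (e i)) (m LinearMap.id z)) l (𝓝 (m L z)) := by
    intro z
    induction z using TensorProduct.induction_on with
    | zero => simp
    | tmul b ξ =>
      have h1 : ∀ i, π (L (e i)) (m LinearMap.id (b ⊗ₜ ξ)) = π (L (e i * b)) ξ := fun i => by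
        rw [hm, hL, map_mul]
        rfl
      rw [funext h1, hm]
      have h2 : Continuous fun b => π (L b) ξ := (hpc.comp L.continuous).clm_apply continuous_const
      exact (h2.tendsto b).comp (he b)
    | add x y hx hy =>
      simp only [map_add]
      exact hx.add hy
  -- The bound passes to the limit because `‖π(L(e_i))‖ ≤ C` for every `i`.
  have hn : ∀ z, ‖m L z‖ ≤ C * ‖m LinearMap.id z‖ := fun z => by
    refine le_of_tendsto (ht z).norm (Filter.Eventually.of_forall fun i => ?_)
    refine (ContinuousLinearMap.le_opNorm _ _).trans ?_
    gcongr
    exact (hc _).trans ((hC _).trans (mul_le_of_le_one_right hC0 (he1 i)))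
  refine ⟨LinearMap.extendOfNorm (m L) (m LinearMap.id), fun b ξ => ?_, fun ξ => ?_⟩
  · have := LinearMap.extendOfNorm_eq hd ⟨C, hn⟩ (b ⊗ₜ ξ)
    rwa [hm, hm] at this
  · exact LinearMap.norm_extendOfNorm_apply_le hd C hn ξ

end Nondegenerate

/-! ### Left multipliers of the crossed product -/

section MulShift

variable {p : ℝ≥0∞} [Fact (1 ≤ p)] {G : Type u} [Group G] [TopologicalSpace G]
  [IsTopologicalGroup G] [MeasurableSpace G] [BorelSpace G]
  {A : Type v} [NormedRing A] [NormedAlgebra ℂ A] [CompleteSpace A]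
  {μ : Measure G} [μ.IsHaarMeasure] {α : IsoAction G A}

theorem IsoAction.one_apply (α : IsoAction G A) (a : A) : α 1 a = a := by
  rw [map_one α.toHom]
  rfl

/-- Unitality is not part of an action; it follows from multiplicativity and surjectivity, by
applying `α s` to `1 * b` with `α s b = 1`. -/
theorem IsoAction.apply_one (α : IsoAction G A) (s : G) : α s 1 = 1 := by
  have h := α.map_mul' s 1 ((α s).symm 1)
  rwa [LinearIsometryEquiv.apply_symm_apply, one_mul, LinearIsometryEquiv.apply_symm_apply,
    mul_one, eq_comm] at h

theorem CovRep.π_one (ρ : CovRep.{u, v, w} p α) : ρ.π 1 = 1 := by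
  refine eq_of_nondegenerate ρ.nondegenerate fun a ξ => ?_
  change (ρ.π 1 * ρ.π a) ξ = ρ.π a ξ
  rw [← map_mul, one_mul]

variable (α) in
/-- The function `t ↦ a α_s(f(s⁻¹ t))`. -/
def mulShiftFn (a : A) (s : G) : C_c(G, A) →ₗ[ℂ] C_c(G, A) where
  toFun f :=
    { toFun := fun t => a * α s (f (s⁻¹ * t))
      continuous_toFun := continuous_const.mul
        ((α s).continuous.comp (f.continuous.comp (continuous_const_mul _)))
      hasCompactSupport' :=
        (f.hasCompactSupport.comp_homeomorph (Homeomorph.mulLeft s⁻¹)).mono fun t ht => by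
          contrapose! ht
          simp only [Function.mem_support, not_not, Function.comp_apply,
            Homeomorph.coe_mulLeft] at ht ⊢
          simp [ht] }
  map_add' f g := by
    ext t
    simp [mul_add]
  map_smul' c f := by
    ext t
    simp

theorem mulShiftFn_apply (a : A) (s : G) (f : C_c(G, A)) (t : G) :
    mulShiftFn α a s f t = a * α s (f (s⁻¹ * t)) := rfl

/-- Left invariance of `μ` replaces `t` by `s t`, and covariance moves `V_s` past `π`. Thus
`mulShiftFn` is left multiplication by the formal element `a u_s`. -/
theorem CovRep.integrated_mulShiftFn (ρ : CovRep.{u, v, w} p α) (a : A) (s : G) (f : C_c(G, A))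
    (ξ : ρ.E) : ρ.integrated μ (mulShiftFn α a s f) ξ = ρ.π a (ρ.V s (ρ.integrated μ f ξ)) := by
  have h := ((ρ.π a).comp
      (ρ.V s).toContinuousLinearEquiv.toContinuousLinearMap).integral_comp_comm
      (ρ.integrable_integrand μ f ξ)
  refine Eq.trans ?_ h
  rw [ρ.integrated_apply, ← integral_mul_left_eq_self _ s]
  refine integral_congr_ae (Filter.Eventually.of_forall fun t => ?_)
  simp only [mulShiftFn_apply, inv_mul_cancel_left, map_mul]
  change ρ.π a (ρ.π (α s (f t)) (ρ.V s (ρ.V t ξ))) = ρ.π a (ρ.V s (ρ.π (f t) (ρ.V t ξ)))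
  rw [ρ.V_π]

theorem CovRep.norm_integrated_mulShiftFn_le (ρ : CovRep.{u, v, w} p α) (a : A) (s : G)
    (f : C_c(G, A)) :
    ‖ρ.integrated μ (mulShiftFn α a s f)‖ ≤ ‖ρ.π a‖ * ‖ρ.integrated μ f‖ := by
  refine ContinuousLinearMap.opNorm_le_bound _ (by positivity) fun ξ => ?_
  rw [ρ.integrated_mulShiftFn, mul_assoc]
  refine (ContinuousLinearMap.le_opNorm _ _).trans ?_
  rw [LinearIsometryEquiv.norm_map]
  gcongr
  exact ContinuousLinearMap.le_opNorm _ _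

namespace LpCrossedProduct

theorem norm_ofFn_mulShiftFn_le (a : A) (s : G) (f : C_c(G, A)) :
    ‖(ofFnₗ.{u, v, w} p μ α ∘ₗ mulShiftFn α a s) f‖ ≤ ‖a‖ * ‖ofFnₗ.{u, v, w} p μ α f‖ := by
  refine norm_le_of_forall_integratedL (by positivity) fun ρ => ?_
  rw [LinearMap.comp_apply, ofFnₗ_apply, ofFnₗ_apply, ρ.integratedL_ofFn]
  refine (ρ.norm_integrated_mulShiftFn_le a s f).trans ?_
  gcongr
  · exact ρ.contractive a
  · rw [← ρ.integratedL_ofFn]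
    exact ρ.norm_integratedL_le _

variable (p μ α) in
/-- The left multiplier `f ↦ (t ↦ a α_s(f(s⁻¹ t)))` of the crossed product. -/
def mulShift (a : A) (s : G) :
    LpCrossedProduct.{u, v, w} p μ α →L[ℂ] LpCrossedProduct.{u, v, w} p μ α :=
  LinearMap.extendOfNorm (ofFnₗ.{u, v, w} p μ α ∘ₗ mulShiftFn α a s) (ofFnₗ.{u, v, w} p μ α)

theorem mulShift_ofFn (a : A) (s : G) (f : C_c(G, A)) :
    mulShift.{u, v, w} p μ α a s (ofFn p μ α f) = ofFn p μ α (mulShiftFn α a s f) :=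
  LinearMap.extendOfNorm_eq (e := ofFnₗ.{u, v, w} p μ α) (denseRange_ofFn p μ α)
    ⟨‖a‖, norm_ofFn_mulShiftFn_le a s⟩ f

theorem norm_mulShift_le (a : A) (s : G) (x : LpCrossedProduct.{u, v, w} p μ α) :
    ‖mulShift.{u, v, w} p μ α a s x‖ ≤ ‖a‖ * ‖x‖ :=
  LinearMap.norm_extendOfNorm_apply_le (e := ofFnₗ.{u, v, w} p μ α) (denseRange_ofFn p μ α) ‖a‖
    (norm_ofFn_mulShiftFn_le a s) x

end LpCrossedProduct

open LpCrossedProduct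

theorem CovRep.integratedL_mulShift (ρ : CovRep.{u, v, w} p α) (a : A) (s : G)
    (x : LpCrossedProduct.{u, v, w} p μ α) (ξ : ρ.E) :
    ρ.integratedL μ (mulShift p μ α a s x) ξ = ρ.π a (ρ.V s (ρ.integratedL μ x ξ)) := by
  have hx : Continuous fun x => ρ.integratedL μ x ξ :=
    (ρ.integratedL μ).continuous.clm_apply continuous_const
  refine (denseRange_ofFn p μ α).induction_on x
    (isClosed_eq (hx.comp (mulShift p μ α a s).continuous)
      ((ρ.π a).continuous.comp ((ρ.V s).continuous.comp hx))) fun f => ?_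
  rw [mulShift_ofFn, ρ.integratedL_ofFn, ρ.integratedL_ofFn, ρ.integrated_mulShiftFn]

namespace LpCrossedProduct

/-- `norm_mulShift_le` would leave a factor `‖1‖`, which a `NormedRing` does not force to be one.
The factor disappears because nondegeneracy makes `ρ.π 1` the identity. Contractivity here is what
later makes the group act by isometries. -/
theorem norm_mulShift_one_le (s : G) (x : LpCrossedProduct.{u, v, w} p μ α) :
    ‖mulShift.{u, v, w} p μ α 1 s x‖ ≤ ‖x‖ := by
  refine norm_le_of_forall_integratedL (norm_nonneg x) fun ρ => ?_
  refine ContinuousLinearMap.opNorm_le_bound _ (norm_nonneg x) fun ξ => ?_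
  rw [ρ.integratedL_mulShift, ρ.π_one, one_apply_eq_self, LinearIsometryEquiv.norm_map]
  exact (ContinuousLinearMap.le_opNorm _ _).trans (by gcongr; exact ρ.norm_integratedL_le x)

theorem mulShift_mul (a : A) (s : G) (x y : LpCrossedProduct.{u, v, w} p μ α) :
    mulShift p μ α a s (x * y) = mulShift p μ α a s x * y := by
  refine ext_integratedL fun ρ => ContinuousLinearMap.ext fun ξ => ?_
  rw [ρ.integratedL_mulShift, ρ.integratedL_mul, ρ.integratedL_mul]
  exact (ρ.integratedL_mulShift a s x _).symm

/-- The rule `(a u_s)(b u_t) = a α_s(b) u_{st}`, which contains the multiplicativity of both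
disintegrated representations and their covariance. -/
theorem mulShift_mulShift (a b : A) (s t : G) (x : LpCrossedProduct.{u, v, w} p μ α) :
    mulShift p μ α a s (mulShift p μ α b t x) = mulShift p μ α (a * α s b) (s * t) x := by
  refine ext_integratedL fun ρ => ContinuousLinearMap.ext fun ξ => ?_
  simp only [ρ.integratedL_mulShift, map_mul, ρ.V_π]
  rfl

theorem mulShift_one_one (x : LpCrossedProduct.{u, v, w} p μ α) : mulShift p μ α 1 1 x = x := by
  refine ext_integratedL fun ρ => ContinuousLinearMap.ext fun ξ => ?_
  rw [ρ.integratedL_mulShift, ρ.π_one, map_one]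
  rfl

theorem mulShift_add (a b : A) (s : G) (x : LpCrossedProduct.{u, v, w} p μ α) :
    mulShift p μ α (a + b) s x = mulShift p μ α a s x + mulShift p μ α b s x := by
  refine ext_integratedL fun ρ => ContinuousLinearMap.ext fun ξ => ?_
  rw [map_add, add_apply, ρ.integratedL_mulShift, ρ.integratedL_mulShift, ρ.integratedL_mulShift,
    map_add, add_apply]

theorem mulShift_smul (c : ℂ) (a : A) (s : G) (x : LpCrossedProduct.{u, v, w} p μ α) :
    mulShift p μ α (c • a) s x = c • mulShift p μ α a s x := by
  refine ext_integratedL fun ρ => ContinuousLinearMap.ext fun ξ => ?_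
  rw [map_smul, smul_apply, ρ.integratedL_mulShift, ρ.integratedL_mulShift, map_smul, smul_apply]

theorem mulShift_zero (s : G) (x : LpCrossedProduct.{u, v, w} p μ α) :
    mulShift p μ α 0 s x = 0 := by
  rw [← zero_smul ℂ (0 : A), mulShift_smul, zero_smul]

/-- Splits `a u_s` into a factor that is norm continuous in `a` and a factor treated through strong
continuity in `s`; `continuous_mulShift` combines the two. -/
theorem mulShift_eq_comp (a : A) (s : G) (x : LpCrossedProduct.{u, v, w} p μ α) :
    mulShift p μ α a s x = mulShift p μ α a 1 (mulShift p μ α 1 s x) := by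
  rw [mulShift_mulShift, one_mul]
  rw [α.one_apply, mul_one]

/-- Twisting sends `a u_s` to `χ(s) θ(a) u_s`. The case `s = 1` yields covariance of the second
group with `A`, and the case `a = 1` yields its commutation relation with `V`. -/
theorem twistIso_mulShift (χ : PontryaginDual G) (θ : A ≃ₗᵢ[ℂ] A)
    (hmul : ∀ a b, θ (a * b) = θ a * θ b) (hθ : ∀ g a, θ (α g a) = α g (θ a)) (a : A) (s : G)
    (x : LpCrossedProduct.{u, v, w} p μ α) :
    twistIso p μ χ θ hmul hθ (mulShift p μ α a s x) =
      (χ s : ℂ) • mulShift p μ α (θ a) s (twistIso p μ χ θ hmul hθ x) := by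
  have hc := (twistIso (α := α) p μ χ θ hmul hθ).continuous
  have hc' : Continuous fun x =>
      (χ s : ℂ) • mulShift p μ α (θ a) s (twistIso p μ χ θ hmul hθ x) :=
    ((mulShift p μ α (θ a) s).continuous.comp hc).const_smul (χ s : ℂ)
  refine (denseRange_ofFn p μ α).induction_on x
    (isClosed_eq (hc.comp (mulShift p μ α a s).continuous) hc') fun f => ?_
  have h : ∀ f : C_c(G, A), twistIso.{u, v, w} p μ χ θ hmul hθ (ofFn p μ α f) =
    ofFn p μ α (twistFn χ θ f) := fun f => twistIso_ofConv χ θ hmul hθ _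
  rw [mulShift_ofFn, h, h, mulShift_ofFn, ← ofFnₗ_apply, ← ofFnₗ_apply, ← map_smul]
  congr 1
  ext t
  have h : (χ t : ℂ) = (χ s : ℂ) * (χ (s⁻¹ * t) : ℂ) := by
    rw [← Circle.coe_mul, ← map_mul, mul_inv_cancel_left]
  simp only [twistFn_apply, mulShiftFn_apply, CompactlySupportedContinuousMap.coe_smul,
    Pi.smul_apply, hmul, hθ, map_smul, h, mul_smul_comm, mul_smul]

variable (p μ α) in
/-- The multipliers given by elements of `A`, as a bounded linear map. -/
def mulL : A →L[ℂ] (LpCrossedProduct.{u, v, w} p μ α →L[ℂ] LpCrossedProduct.{u, v, w} p μ α) :=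
  LinearMap.mkContinuous
    { toFun := fun a => mulShift p μ α a 1
      map_add' := fun a b => ContinuousLinearMap.ext fun x => mulShift_add a b 1 x
      map_smul' := fun c a => ContinuousLinearMap.ext fun x => mulShift_smul c a 1 x } 1
    (fun a => by
      rw [one_mul]
      exact ContinuousLinearMap.opNorm_le_bound _ (norm_nonneg a) (norm_mulShift_le a 1))

theorem mulL_apply (a : A) (x : LpCrossedProduct.{u, v, w} p μ α) :
    mulL p μ α a x = mulShift p μ α a 1 x := rfl

section LocallyCompact

variable [LocallyCompactSpace G]

theorem continuous_mulShift_one_ofFn (f : C_c(G, A)) :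
    Continuous fun s => mulShift.{u, v, w} p μ α 1 s (ofFn p μ α f) := by
  rw [continuous_iff_continuousAt]
  intro s₀
  -- For `s` in a compact neighborhood `N` all shifted functions vanish off the compact set `N *
  -- tsupport f`, so their `L^1` distance to the shift by `s₀` is continuous in `s`; it dominates
  -- the crossed product norm.
  obtain ⟨N, hN, hs₀⟩ := exists_compact_mem_nhds s₀
  rw [ContinuousAt, tendsto_iff_norm_sub_tendsto_zero]
  have h1 : Continuous fun q : G × G => mulShiftFn α 1 q.1 f q.2 :=
    continuous_const.mul (α.joint.comp (continuous_fst.prodMk (f.continuous.comp (by fun_prop))))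
  have h2 : ContinuousOn (fun s => ∫ t, ‖mulShiftFn α 1 s f t - mulShiftFn α 1 s₀ f t‖ ∂μ) N := by
    refine continuousOn_integral_of_compact_support
      (hN.mul f.hasCompactSupport.isCompact)
      (h1.sub (h1.comp (continuous_const.prodMk continuous_snd))).norm.continuousOn
      fun s t hs ht => ?_
    have h3 : ∀ s ∈ N, f (s⁻¹ * t) = 0 := fun s hs => by
      by_contra hne
      exact ht ⟨s, hs, s⁻¹ * t, subset_tsupport _ hne, by simp⟩
    simp [mulShiftFn_apply, h3 s hs, h3 s₀ (mem_of_mem_nhds hs₀)]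
  have h3 := (h2.continuousAt hs₀).tendsto
  simp only [sub_self, norm_zero, integral_zero] at h3
  refine squeeze_zero (fun _ => norm_nonneg _) (fun s => ?_) h3
  rw [mulShift_ofFn, mulShift_ofFn, ← ofFnₗ_apply, ← ofFnₗ_apply, ← map_sub]
  exact norm_ofFn_le_integral _

theorem continuous_mulShift_one (x : LpCrossedProduct.{u, v, w} p μ α) :
    Continuous fun s => mulShift p μ α 1 s x := by
  rw [Metric.continuous_iff']
  intro s₀ ε hε
  obtain ⟨f, hf⟩ := (denseRange_ofFn p μ α).exists_dist_lt x (ε := ε / 3) (by positivity)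
  filter_upwards [Metric.continuous_iff'.1 (continuous_mulShift_one_ofFn.{u, v, w} (p := p)
    (μ := μ) (α := α) f) s₀ (ε / 3) (by positivity)] with s hs
  have h : ∀ s, dist (mulShift p μ α 1 s x) (mulShift p μ α 1 s (ofFn p μ α f)) < ε / 3 :=
    fun s => by
      rw [dist_eq_norm, ← map_sub]
      rw [dist_eq_norm] at hf
      exact (norm_mulShift_one_le s _).trans_lt hf
  have h0 := h s₀
  rw [dist_comm] at h0
  have := dist_triangle4 (mulShift p μ α 1 s x) (mulShift p μ α 1 s (ofFn p μ α f))
    (mulShift p μ α 1 s₀ (ofFn p μ α f)) (mulShift p μ α 1 s₀ x)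
  linarith [h s]

theorem continuous_mulShift (f : C_c(G, A)) (x : LpCrossedProduct.{u, v, w} p μ α) :
    Continuous fun s => mulShift p μ α (f s) s x := by
  have h : Continuous fun s => mulL p μ α (f s) (mulShift p μ α 1 s x) :=
    ((mulL p μ α).continuous.comp f.continuous).clm_apply (continuous_mulShift_one x)
  simpa only [mulL_apply, ← mulShift_eq_comp] using h

theorem integrable_mulShift (f : C_c(G, A)) (x : LpCrossedProduct.{u, v, w} p μ α) :
    Integrable (fun s => mulShift p μ α (f s) s x) μ :=
  (continuous_mulShift f x).integrable_of_hasCompactSupport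
    (HasCompactSupport.intro f.hasCompactSupport.isCompact fun s hs => by
      rw [image_eq_zero_of_notMem_tsupport hs, mulShift_zero])

/-- The meaning is `f = ∫ f(s) u_s` as a multiplier. It is checked in each integrated form, where it
is the definition of that form. Both the approximate identity and the recovery of a representation
from its disintegration rest on it. -/
theorem ofFn_mul (f : C_c(G, A)) (x : LpCrossedProduct.{u, v, w} p μ α) :
    ofFn p μ α f * x = ∫ s, mulShift p μ α (f s) s x ∂μ := by
  refine ext_integratedL fun ρ => ContinuousLinearMap.ext fun ξ => ?_
  have h := ((ContinuousLinearMap.apply ℂ ρ.E ξ).comp (ρ.integratedL μ)).integral_comp_comm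
    (integrable_mulShift f x)
  refine Eq.trans ?_ h
  rw [ρ.integratedL_mul, ρ.integratedL_ofFn]
  refine (ρ.integrated_apply μ f _).trans ?_
  refine integral_congr_ae (Filter.Eventually.of_forall fun s => ?_)
  exact (ρ.integratedL_mulShift _ _ _ _).symm

end LocallyCompact

end LpCrossedProduct

end MulShift

/-! ### Approximate identities -/

section Bump

variable {G : Type u} [Group G] [TopologicalSpace G]
  [IsTopologicalGroup G] [LocallyCompactSpace G] [MeasurableSpace G] [BorelSpace G]
  (μ : Measure G) [μ.IsHaarMeasure]

/-- Every neighborhood of the identity supports a nonnegative continuous compactly supported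
function with integral one. -/
theorem exists_bump {U : Set G} (hU : U ∈ 𝓝 (1 : G)) :
    ∃ e : C_c(G, ℝ), (∀ s, 0 ≤ e s) ∧ ∫ s, e s ∂μ = 1 ∧ ∀ s ∉ U, e s = 0 := by
  obtain ⟨f, h1, h2, h3, h4⟩ := exists_continuousMap_one_of_isCompact_subset_isOpen
    (isCompact_singleton (x := (1 : G))) isOpen_interior
    (Set.singleton_subset_iff.2 (mem_interior_iff_mem_nhds.2 hU))
  have hpos : 0 < ∫ s, f s ∂μ :=
    f.continuous.integral_pos_of_hasCompactSupport_nonneg_nonzero h2 (fun s => (h4 s).1)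
      (x := 1) (by simp [h1 rfl])
  refine ⟨(∫ s, f s ∂μ)⁻¹ • ⟨f, h2⟩, fun s => ?_, ?_, fun s hs => ?_⟩
  · have := (h4 s).1
    change 0 ≤ (∫ s, f s ∂μ)⁻¹ * f s
    positivity
  · change ∫ s, (∫ s, f s ∂μ)⁻¹ * f s ∂μ = 1
    rw [integral_const_mul, inv_mul_cancel₀ hpos.ne']
  · change (∫ s, f s ∂μ)⁻¹ * f s = 0
    rw [image_eq_zero_of_notMem_tsupport fun h => hs (interior_subset (h3 h)), mul_zero]

open Classical in
/-- A nonnegative function with integral one supported in a given neighborhood of the identity. -/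
def bump (U : Set G) : C_c(G, ℝ) :=
  if hU : U ∈ 𝓝 (1 : G) then (exists_bump μ hU).choose else 0

theorem bump_nonneg (U : Set G) (s : G) : 0 ≤ bump μ U s := by
  rw [bump]
  split_ifs with hU
  · exact (exists_bump μ hU).choose_spec.1 s
  · exact le_rfl

theorem integral_bump {U : Set G} (hU : U ∈ 𝓝 (1 : G)) : ∫ s, bump μ U s ∂μ = 1 := by
  rw [bump, dif_pos hU]
  exact (exists_bump μ hU).choose_spec.2.1

theorem bump_eq_zero {U : Set G} (hU : U ∈ 𝓝 (1 : G)) {s : G} (hs : s ∉ U) : bump μ U s = 0 := by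
  rw [bump, dif_pos hU]
  exact (exists_bump μ hU).choose_spec.2.2 s hs

/-- The default value `0` of `bump` off the neighborhoods of `1` makes the bound hold for every set,
as `exists_extend_multiplier` asks for a bound at every index. -/
theorem integral_bump_le_one (U : Set G) : ∫ s, bump μ U s ∂μ ≤ 1 := by
  by_cases hU : U ∈ 𝓝 (1 : G)
  · exact (integral_bump μ hU).le
  · rw [bump, dif_neg hU]
    simp

/-- The filter of small neighborhoods of the identity. -/
def bumpFilter : Filter (Set G) := (𝓝 (1 : G)).smallSets ⊓ Filter.principal {U | U ∈ 𝓝 (1 : G)}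

/-- The principal filter discards sets that are not neighborhoods, where `bump` is zero; arbitrarily
small neighborhoods remain. -/
instance : (bumpFilter (G := G)).NeBot :=
  Filter.frequently_iff_neBot.1 (Filter.frequently_smallSets_mem (𝓝 (1 : G)))

variable {E : Type*} [NormedAddCommGroup E] [NormedSpace ℂ E]

theorem integrable_bump_smul (U : Set G) {F : G → E} (hF : Continuous F) :
    Integrable (fun s => (bump μ U s : ℂ) • F s) μ := by
  refine Continuous.integrable_of_hasCompactSupport ?_
    (HasCompactSupport.intro (bump μ U).hasCompactSupport.isCompact fun s hs => by
      rw [image_eq_zero_of_notMem_tsupport hs, Complex.ofReal_zero, zero_smul])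
  exact (Complex.continuous_ofReal.comp (bump μ U).continuous).smul hF

theorem norm_integral_bump_smul_le (U : Set G) {F : G → E} {C : ℝ} (hC0 : 0 ≤ C)
    (hC : ∀ s, bump μ U s ≠ 0 → ‖F s‖ ≤ C) : ‖∫ s, (bump μ U s : ℂ) • F s ∂μ‖ ≤ C := by
  have h1 : Integrable (fun s => bump μ U s * C) μ :=
    ((bump μ U).continuous.integrable_of_hasCompactSupport (bump μ U).hasCompactSupport).mul_const C
  refine (norm_integral_le_of_norm_le h1 (Filter.Eventually.of_forall fun s => ?_)).trans ?_
  · rw [norm_smul, Complex.norm_real, Real.norm_of_nonneg (bump_nonneg μ U s)]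
    by_cases h : bump μ U s = 0
    · simp [h]
    · exact mul_le_mul_of_nonneg_left (hC s h) (bump_nonneg μ U s)
  · rw [integral_mul_const]
    exact mul_le_of_le_one_left hC0 (integral_bump_le_one μ U)

theorem tendsto_integral_bump_smul [CompleteSpace E] {F : G → E} (hF : Continuous F) :
    Filter.Tendsto (fun U => ∫ s, (bump μ U s : ℂ) • F s ∂μ) bumpFilter
      (𝓝 (F 1)) := by
  rw [Metric.tendsto_nhds]
  intro ε hε
  have h1 : ∀ᶠ s in 𝓝 (1 : G), dist (F s) (F 1) < ε / 2 :=
    Metric.continuous_iff'.1 hF 1 (ε / 2) (by positivity)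
  filter_upwards [Filter.Eventually.filter_mono inf_le_left
      (Filter.eventually_smallSets_forall.2 h1),
    Filter.mem_inf_of_right (Filter.mem_principal_self _)] with U hU hU1
  have h2 : ∫ s, (bump μ U s : ℂ) • F s ∂μ - F 1 = ∫ s, (bump μ U s : ℂ) • (F s - F 1) ∂μ := by
    simp only [smul_sub]
    rw [integral_sub (integrable_bump_smul μ U hF) (integrable_bump_smul μ U continuous_const),
      integral_smul_const, integral_complex_ofReal, integral_bump μ hU1]
    simp
  rw [dist_eq_norm, h2]
  refine (norm_integral_bump_smul_le μ U (by positivity) fun s hs => ?_).trans_lt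
    (half_lt_self hε)
  rw [← dist_eq_norm]
  exact (hU s (by_contra fun h => hs (bump_eq_zero μ hU1 h))).le

end Bump

/-! ### Disintegration of representations of the crossed product -/

section Disintegration

variable {p : ℝ≥0∞} [Fact (1 ≤ p)] {G : Type u} [Group G] [TopologicalSpace G]
  [IsTopologicalGroup G] [LocallyCompactSpace G] [MeasurableSpace G] [BorelSpace G]
  {A : Type v} [NormedRing A] [NormedAlgebra ℂ A] [CompleteSpace A]
  {μ : Measure G} [μ.IsHaarMeasure] {α : IsoAction G A}

variable (A μ) in
/-- The `A`-valued function `s ↦ bump(s) 1`. -/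
def bumpFn (U : Set G) : C_c(G, A) where
  toFun s := (bump μ U s : ℂ) • (1 : A)
  continuous_toFun := (Complex.continuous_ofReal.comp (bump μ U).continuous).smul continuous_const
  hasCompactSupport' := HasCompactSupport.intro
    (bump μ U).hasCompactSupport.isCompact fun s hs => by
    rw [image_eq_zero_of_notMem_tsupport hs, Complex.ofReal_zero, zero_smul]

theorem bumpFn_apply (U : Set G) (s : G) : bumpFn A μ U s = (bump μ U s : ℂ) • (1 : A) := rfl

theorem CovRep.integrated_bumpFn (ρ : CovRep.{u, v, w} p α) (U : Set G) (ξ : ρ.E) :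
    ρ.integrated μ (bumpFn A μ U) ξ = ∫ s, (bump μ U s : ℂ) • ρ.V s ξ ∂μ := by
  rw [ρ.integrated_apply]
  refine integral_congr_ae (Filter.Eventually.of_forall fun s => ?_)
  simp only [bumpFn_apply, map_smul, ρ.π_one, smul_apply, one_apply_eq_self]

theorem CovRep.tendsto_integrated_bumpFn (ρ : CovRep.{u, v, w} p α) (ξ : ρ.E) :
    Filter.Tendsto (fun U => ρ.integrated μ (bumpFn A μ U) ξ) bumpFilter (𝓝 ξ) := by
  simp only [ρ.integrated_bumpFn]
  have h := tendsto_integral_bump_smul μ (ρ.continuous_V ξ)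
  rwa [map_one ρ.V] at h

/-- Averages of `V_s ξ` over shrinking neighborhoods of `1` converge to `ξ` and lie in the range of
the integrated form. This supplies the nondegeneracy that an iterated covariant representation
requires. -/
theorem CovRep.dense_integratedL (ρ : CovRep.{u, v, w} p α) :
    (Submodule.span ℂ {η | ∃ x ξ, η = ρ.integratedL μ x ξ}).topologicalClosure = ⊤ := by
  rw [eq_top_iff]
  intro ξ _
  refine mem_closure_of_tendsto (ρ.tendsto_integrated_bumpFn (μ := μ) ξ)
    (Filter.Eventually.of_forall fun U => Submodule.subset_span
      ⟨LpCrossedProduct.ofFn p μ α (bumpFn A μ U), ξ, ?_⟩)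
  rw [ρ.integratedL_ofFn]

namespace LpCrossedProduct

/-- The `L^1` estimate would again cost a factor `‖1‖`; in each representation the function acts as
an average of isometries with total mass at most one. -/
theorem norm_ofFn_bumpFn_le (U : Set G) : ‖ofFn.{u, v, w} p μ α (bumpFn A μ U)‖ ≤ 1 := by
  refine norm_le_of_forall_integratedL zero_le_one fun ρ => ?_
  refine ContinuousLinearMap.opNorm_le_bound _ zero_le_one fun ξ => ?_
  rw [ρ.integratedL_ofFn, ρ.integrated_bumpFn, one_mul]
  exact norm_integral_bump_smul_le μ U (norm_nonneg ξ) fun s _ => by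
    rw [LinearIsometryEquiv.norm_map]

theorem tendsto_ofFn_bumpFn_mul (x : LpCrossedProduct.{u, v, w} p μ α) :
    Filter.Tendsto (fun U => ofFn.{u, v, w} p μ α (bumpFn A μ U) * x) bumpFilter (𝓝 x) := by
  have h := tendsto_integral_bump_smul μ (continuous_mulShift_one x)
  rw [mulShift_one_one] at h
  simpa only [ofFn_mul, bumpFn_apply, mulShift_smul] using h

section Rep

variable {E : Type*} [NormedAddCommGroup E] [NormedSpace ℂ E] [CompleteSpace E]
  {σ : LpCrossedProduct.{u, v, w} p μ α →ₙₐ[ℂ] (E →L[ℂ] E)}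

theorem exists_repA (hc : ∀ x, ‖σ x‖ ≤ ‖x‖)
    (hn : (Submodule.span ℂ {η | ∃ x ξ, η = σ x ξ}).topologicalClosure = ⊤) (a : A) :
    ∃ T : E →L[ℂ] E, (∀ x ξ, T (σ x ξ) = σ (mulShift p μ α a 1 x) ξ) ∧ ∀ ξ, ‖T ξ‖ ≤ ‖a‖ * ‖ξ‖ :=
  exists_extend_multiplier σ hc hn (fun U => ofFn.{u, v, w} p μ α (bumpFn A μ U))
    norm_ofFn_bumpFn_le tendsto_ofFn_bumpFn_mul _ (mulShift_mul a 1) (norm_nonneg a)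
    (norm_mulShift_le a 1)

theorem exists_repG (hc : ∀ x, ‖σ x‖ ≤ ‖x‖)
    (hn : (Submodule.span ℂ {η | ∃ x ξ, η = σ x ξ}).topologicalClosure = ⊤) (s : G) :
    ∃ T : E →L[ℂ] E, (∀ x ξ, T (σ x ξ) = σ (mulShift p μ α 1 s x) ξ) ∧ ∀ ξ, ‖T ξ‖ ≤ 1 * ‖ξ‖ :=
  exists_extend_multiplier σ hc hn (fun U => ofFn.{u, v, w} p μ α (bumpFn A μ U))
    norm_ofFn_bumpFn_le tendsto_ofFn_bumpFn_mul _ (mulShift_mul 1 s) zero_le_one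
    (fun x => (norm_mulShift_one_le s x).trans_eq (one_mul _).symm)

variable (hc : ∀ x, ‖σ x‖ ≤ ‖x‖)
  (hn : (Submodule.span ℂ {η | ∃ x ξ, η = σ x ξ}).topologicalClosure = ⊤)

/-- The operator by which an element of the coefficient algebra acts on the space of a
nondegenerate representation of the crossed product. -/
def repAOp (a : A) : E →L[ℂ] E := (exists_repA hc hn a).choose

theorem repAOp_apply (a : A) (x : LpCrossedProduct.{u, v, w} p μ α) (ξ : E) :
    repAOp hc hn a (σ x ξ) = σ (mulShift p μ α a 1 x) ξ :=
  (exists_repA hc hn a).choose_spec.1 x ξ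

theorem norm_repAOp_le (a : A) : ‖repAOp hc hn a‖ ≤ ‖a‖ :=
  ContinuousLinearMap.opNorm_le_bound _ (norm_nonneg a) (exists_repA hc hn a).choose_spec.2

/-- The operator by which a group element acts on the space of a nondegenerate representation of
the crossed product. -/
def repGOp (s : G) : E →L[ℂ] E := (exists_repG hc hn s).choose

theorem repGOp_apply (s : G) (x : LpCrossedProduct.{u, v, w} p μ α) (ξ : E) :
    repGOp hc hn s (σ x ξ) = σ (mulShift p μ α 1 s x) ξ :=
  (exists_repG hc hn s).choose_spec.1 x ξ

theorem norm_repGOp_le (s : G) (ξ : E) : ‖repGOp hc hn s ξ‖ ≤ ‖ξ‖ :=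
  ((exists_repG hc hn s).choose_spec.2 ξ).trans_eq (one_mul _)

theorem repAOp_mul (a b : A) : repAOp hc hn (a * b) = repAOp hc hn a * repAOp hc hn b := by
  refine eq_of_nondegenerate hn fun x ξ => ?_
  change _ = repAOp hc hn a (repAOp hc hn b (σ x ξ))
  simp only [repAOp_apply, mulShift_mulShift, one_mul, α.one_apply]

theorem repAOp_one : repAOp hc hn 1 = 1 := by
  refine eq_of_nondegenerate hn fun x ξ => ?_
  rw [repAOp_apply, mulShift_one_one]
  rfl

theorem repGOp_one : repGOp hc hn 1 = 1 := by
  refine eq_of_nondegenerate hn fun x ξ => ?_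
  rw [repGOp_apply, mulShift_one_one]
  rfl

theorem repGOp_mul (s t : G) : repGOp hc hn (s * t) = repGOp hc hn s * repGOp hc hn t := by
  refine eq_of_nondegenerate hn fun x ξ => ?_
  change _ = repGOp hc hn s (repGOp hc hn t (σ x ξ))
  simp only [repGOp_apply, mulShift_mulShift, one_mul, α.apply_one]

theorem repGOp_mul_apply (s t : G) (ξ : E) :
    repGOp hc hn s (repGOp hc hn t ξ) = repGOp hc hn (s * t) ξ := by
  rw [repGOp_mul]
  rfl

theorem repGOp_repAOp (s : G) (a : A) :
    repGOp hc hn s * repAOp hc hn a = repAOp hc hn (α s a) * repGOp hc hn s := by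
  refine eq_of_nondegenerate hn fun x ξ => ?_
  change repGOp hc hn s (repAOp hc hn a (σ x ξ)) =
    repAOp hc hn (α s a) (repGOp hc hn s (σ x ξ))
  simp only [repGOp_apply, repAOp_apply, mulShift_mulShift, one_mul, mul_one, α.one_apply]

/-- The coefficient algebra acts on the space of a nondegenerate representation of the crossed
product. -/
def repA : A →ₙₐ[ℂ] (E →L[ℂ] E) where
  toFun := repAOp hc hn
  map_smul' c a := eq_of_nondegenerate hn fun x ξ => by
    rw [repAOp_apply, mulShift_smul, map_smul, smul_apply]
    exact congrArg (c • ·) (repAOp_apply hc hn a x ξ).symm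
  map_zero' := eq_of_nondegenerate hn fun x ξ => by
    rw [repAOp_apply, mulShift_zero, map_zero]
    rfl
  map_add' a b := eq_of_nondegenerate hn fun x ξ => by
    rw [repAOp_apply, mulShift_add, map_add, add_apply, add_apply, repAOp_apply, repAOp_apply]
  map_mul' := repAOp_mul hc hn

/-- The group acts by isometries on the space of a nondegenerate representation of the crossed
product. -/
def repG : G →* (E ≃ₗᵢ[ℂ] E) where
  toFun s :=
    { toFun := repGOp hc hn s
      invFun := repGOp hc hn s⁻¹
      map_add' := map_add _
      map_smul' := map_smul _
      left_inv := fun ξ => by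
        rw [repGOp_mul_apply, inv_mul_cancel, repGOp_one]
        rfl
      right_inv := fun ξ => by
        rw [repGOp_mul_apply, mul_inv_cancel, repGOp_one]
        rfl
      norm_map' := fun ξ => by
        change ‖repGOp hc hn s ξ‖ = ‖ξ‖
        -- A contraction whose inverse is also a contraction is an isometry.
        refine le_antisymm (norm_repGOp_le hc hn s ξ) ?_
        have h := norm_repGOp_le hc hn s⁻¹ (repGOp hc hn s ξ)
        rwa [repGOp_mul_apply, inv_mul_cancel, repGOp_one] at h }
  map_one' := LinearIsometryEquiv.ext fun ξ => DFunLike.congr_fun (repGOp_one hc hn) ξ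
  map_mul' s t := LinearIsometryEquiv.ext fun ξ => DFunLike.congr_fun (repGOp_mul hc hn s t) ξ

theorem repG_apply (s : G) (ξ : E) : repG hc hn s ξ = repGOp hc hn s ξ := rfl

/-- On the span of the vectors `σ(x)ξ` continuity comes from that of `s ↦ mulShift 1 s x`; since the
operators are isometries, it passes to the closure. -/
theorem continuous_repG (ξ : E) : Continuous fun s => repG hc hn s ξ := by
  have hd := (Submodule.dense_iff_topologicalClosure_eq_top).2 hn
  have hσ : Continuous σ :=
    AddMonoidHomClass.continuous_of_bound σ 1 fun x => (hc x).trans_eq (one_mul _).symm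
  have h1 : ∀ η ∈ Submodule.span ℂ {η | ∃ x ξ, η = σ x ξ},
      Continuous fun s => repG hc hn s η := fun η hη => by
    induction hη using Submodule.span_induction with
    | mem η h =>
      obtain ⟨x, ξ, rfl⟩ := h
      simp only [repG_apply, repGOp_apply]
      exact (hσ.comp (continuous_mulShift_one x)).clm_apply continuous_const
    | zero => simpa only [map_zero] using continuous_const
    | add η η' _ _ h h' =>
      simp only [map_add]
      exact h.add h'
    | smul c η _ h =>
      simp only [map_smul]
      exact h.const_smul c
  rw [Metric.continuous_iff']
  intro s₀ ε hε
  obtain ⟨η, hη, hd⟩ := Metric.dense_iff.1 hd ξ (ε / 3) (by positivity)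
  rw [Metric.mem_ball] at hη
  filter_upwards [Metric.continuous_iff'.1 (h1 η hd) s₀ (ε / 3) (by positivity)] with s hs
  have := dist_triangle4 (repG hc hn s ξ) (repG hc hn s η) (repG hc hn s₀ η) (repG hc hn s₀ ξ)
  rw [LinearIsometryEquiv.dist_map, LinearIsometryEquiv.dist_map, dist_comm ξ] at this
  linarith

end Rep

/-- The covariant representation given by a nondegenerate contractive representation of the crossed
product. -/
def disintegrate {X : Type w} [MeasurableSpace X] (ν : Measure X) [SigmaFinite ν]
    (σ : LpCrossedProduct.{u, v, w} p μ α →ₙₐ[ℂ] (Lp ℂ p ν →L[ℂ] Lp ℂ p ν))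
    (hc : ∀ x, ‖σ x‖ ≤ ‖x‖)
    (hn : (Submodule.span ℂ {η | ∃ x ξ, η = σ x ξ}).topologicalClosure = ⊤) :
    CovRep.{u, v, w} p α where
  X := X
  ν := ν
  π := repA hc hn
  contractive := norm_repAOp_le hc hn
  nondegenerate := by
    rw [eq_top_iff]
    intro ξ _
    refine subset_closure (Submodule.subset_span ⟨1, ξ, ?_⟩)
    change ξ = repAOp hc hn 1 ξ
    rw [repAOp_one]
    rfl
  V := repG hc hn
  continuous_V := continuous_repG hc hn
  covariant t a ξ := by
    refine Eq.trans (DFunLike.congr_fun (repGOp_repAOp hc hn t a) (repGOp hc hn t⁻¹ ξ)) ?_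
    change repAOp hc hn (α t a) (repGOp hc hn t (repGOp hc hn t⁻¹ ξ)) = repAOp hc hn (α t a) ξ
    rw [repGOp_mul_apply, mul_inv_cancel, repGOp_one]
    rfl

/-- On a vector `σ(x)ξ` the integrated form is `∫ σ(f(s) u_s x)ξ`. Pulling `σ` out of the integral
and using `ofFn_mul` turns this into `σ(f * x)ξ = σ(f)σ(x)ξ`, and nondegeneracy does the rest. -/
theorem integrated_disintegrate {X : Type w} [MeasurableSpace X] (ν : Measure X) [SigmaFinite ν]
    (σ : LpCrossedProduct.{u, v, w} p μ α →ₙₐ[ℂ] (Lp ℂ p ν →L[ℂ] Lp ℂ p ν))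
    (hc : ∀ x, ‖σ x‖ ≤ ‖x‖)
    (hn : (Submodule.span ℂ {η | ∃ x ξ, η = σ x ξ}).topologicalClosure = ⊤) (f : C_c(G, A)) :
    (disintegrate ν σ hc hn).integrated μ f = σ (ofFn p μ α f) := by
  refine eq_of_nondegenerate hn fun x ξ => ?_
  let q : LpCrossedProduct.{u, v, w} p μ α →L[ℂ] (Lp ℂ p ν →L[ℂ] Lp ℂ p ν) :=
    LinearMap.mkContinuous
      { toFun := σ
        map_add' := map_add σ
        map_smul' := fun c a => map_smul σ c a } 1 (fun a => by simpa using hc a)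
  have h := ((ContinuousLinearMap.apply ℂ (Lp ℂ p ν) ξ).comp q).integral_comp_comm
    (integrable_mulShift f x)
  rw [← ofFn_mul] at h
  have h2 : σ (ofFn p μ α f) (σ x ξ) = σ (ofFn p μ α f * x) ξ := by
    rw [map_mul]
    rfl
  refine Eq.trans (Eq.trans ?_ h) h2.symm
  refine integral_congr_ae (Filter.Eventually.of_forall fun s => ?_)
  change repAOp hc hn (f s) (repGOp hc hn s (σ x ξ)) = σ (mulShift p μ α (f s) s x) ξ
  rw [repGOp_apply, repAOp_apply, ← mulShift_eq_comp]

end LpCrossedProduct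

end Disintegration

/-! ### Covariant representations of iterated crossed products -/

section Iterated

variable {p : ℝ≥0∞} [Fact (1 ≤ p)] {G K : Type u} [Group G] [TopologicalSpace G]
  [Group K] [TopologicalSpace K]
  {A : Type v} [NormedRing A] [NormedAlgebra ℂ A]

/-- A representation of `A` together with covariant isometric representations `V` and `U` of two
groups acting on `A`, satisfying the commutation relation `U_k V_s = χ_k(s) V_s U_k`. -/
structure BiCovRep (p : ℝ≥0∞) [Fact (1 ≤ p)] (α : IsoAction G A) (θ : IsoAction K A)
    (χ : K →* PontryaginDual G) where
  /-- the covariant representation of the first group -/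
  base : CovRep.{u, v, w} p α
  /-- the isometric representation of the second group -/
  U : K →* (base.E ≃ₗᵢ[ℂ] base.E)
  continuous_U : ∀ ξ, Continuous fun k => U k ξ
  U_π : ∀ k a ξ, U k (base.π a ξ) = base.π (θ k a) (U k ξ)
  U_V : ∀ k s ξ, U k (base.V s ξ) = (χ k s : ℂ) • base.V s (U k ξ)

namespace BiCovRep

variable {α : IsoAction G A} {θ : IsoAction K A} {χ : K →* PontryaginDual G}

theorem V_U (D : BiCovRep.{u, v, w} p α θ χ) (k : K) (s : G) (ξ : D.base.E) :
    D.base.V s (D.U k ξ) = ((χ k s)⁻¹ : Circle) • D.U k (D.base.V s ξ) := by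
  rw [D.U_V, Circle.smul_def, ← mul_smul, ← Circle.coe_mul, inv_mul_cancel, Circle.coe_one,
    one_smul]

/-- The covariant representation of the second group. -/
def swapBase (D : BiCovRep.{u, v, w} p α θ χ) : CovRep.{u, v, w} p θ where
  X := D.base.X
  ν := D.base.ν
  π := D.base.π
  contractive := D.base.contractive
  nondegenerate := D.base.nondegenerate
  V := D.U
  continuous_V := D.continuous_U
  covariant k a ξ := by
    rw [D.U_π]
    change D.base.π (θ k a) ((D.U k * D.U k⁻¹) ξ) = _
    rw [← map_mul, mul_inv_cancel, map_one]
    rfl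

/-- Exchange the two groups. -/
def swap (D : BiCovRep.{u, v, w} p α θ χ) (χ' : G →* PontryaginDual K)
    (hχχ' : ∀ k s, χ' s k = (χ k s)⁻¹) : BiCovRep.{u, v, w} p θ α χ' where
  base := D.swapBase
  U := D.base.V
  continuous_U := D.base.continuous_V
  U_π := D.base.V_π
  U_V s k ξ := by
    rw [hχχ']
    exact D.V_U k s ξ

variable [IsTopologicalGroup G] [MeasurableSpace G] [BorelSpace G]
  [IsTopologicalGroup K] [MeasurableSpace K] [BorelSpace K]
  [CompleteSpace A] {μ : Measure G} [μ.IsHaarMeasure] {κ : Measure K} [κ.IsHaarMeasure]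

/-- The value `∫∫ π(F(k, s)) V_s U_k ξ` of the integrated form. -/
def int (D : BiCovRep.{u, v, w} p α θ χ) (μ : Measure G) (κ : Measure K) (F : C_c(K × G, A))
    (ξ : D.base.E) : D.base.E :=
  ∫ k, ∫ s, D.base.π (F (k, s)) (D.base.V s (D.U k ξ)) ∂μ ∂κ

/-- Fubini for compactly supported continuous functions exchanges the integrals. Replacing `U_k V_s`
by `χ_k(s) V_s U_k` produces a scalar inverse to the factor `χ'_s(k)` in `F'`. This cancellation is
the reason for the factor in the label change. -/
theorem int_swap (D : BiCovRep.{u, v, w} p α θ χ) (χ' : G →* PontryaginDual K)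
    (hχχ' : ∀ k s, χ' s k = (χ k s)⁻¹) (F : C_c(K × G, A)) (F' : C_c(G × K, A))
    (hF : ∀ k s, F' (s, k) = (χ' s k : ℂ) • F (k, s)) (ξ : D.base.E) :
    (D.swap χ' hχχ').int κ μ F' ξ = D.int μ κ F ξ := by
  have h : Continuous fun q : K × G => D.base.π (F q) (D.base.V q.2 (D.U q.1 ξ)) :=
    D.base.continuous_integrand F.continuous continuous_snd
      ((D.continuous_U ξ).comp continuous_fst)
  have hs : HasCompactSupport fun q : K × G => D.base.π (F q) (D.base.V q.2 (D.U q.1 ξ)) :=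
    HasCompactSupport.intro F.hasCompactSupport.isCompact fun q hq => by
      rw [image_eq_zero_of_notMem_tsupport hq, map_zero, zero_apply]
  refine Eq.trans ?_ (integral_integral_swap_of_hasCompactSupport
    (f := fun k s => D.base.π (F (k, s)) (D.base.V s (D.U k ξ))) h hs).symm
  refine integral_congr_ae (Filter.Eventually.of_forall fun s => ?_)
  refine integral_congr_ae (Filter.Eventually.of_forall fun k => ?_)
  change D.base.π (F' (s, k)) (D.U k (D.base.V s ξ)) = D.base.π (F (k, s)) (D.base.V s (D.U k ξ))
  rw [D.U_V, hF, map_smul, map_smul, smul_apply, ← mul_smul, hχχ', ← Circle.coe_mul,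
    mul_inv_cancel, Circle.coe_one, one_smul]

variable (hθ : ∀ k s a, θ k (α s a) = α s (θ k a)) (hχ : Continuous fun q : K × G => χ q.1 q.2)

/-- Moving `U_k` through `π(f(s)) V_s` produces `θ_k(f(s))` and the scalar `χ_k(s)`, exactly the two
ingredients of the twist. Hence `U` is covariant for the twisted action on the crossed product. -/
theorem U_integratedL (D : BiCovRep.{u, v, w} p α θ χ) (k : K)
    (x : LpCrossedProduct.{u, v, w} p μ α) (ξ : D.base.E) :
    D.U k (D.base.integratedL μ x ξ) =
      D.base.integratedL μ (twistAction p μ θ hθ χ hχ k x) (D.U k ξ) := by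
  have hc : ∀ ξ, Continuous fun x => D.base.integratedL μ x ξ := fun ξ =>
    (D.base.integratedL μ).continuous.clm_apply continuous_const
  refine (LpCrossedProduct.denseRange_ofFn p μ α).induction_on x
    (isClosed_eq ((D.U k).continuous.comp (hc ξ))
      ((hc _).comp (twistAction p μ θ hθ χ hχ k).continuous)) fun f => ?_
  rw [twistAction_ofFn, D.base.integratedL_ofFn, D.base.integratedL_ofFn]
  refine Eq.trans ((D.U k).toContinuousLinearEquiv.toContinuousLinearMap.integral_comp_comm
    (D.base.integrable_integrand μ f ξ)).symm ?_
  refine integral_congr_ae (Filter.Eventually.of_forall fun s => ?_)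
  change D.U k (D.base.π (f s) (D.base.V s ξ)) =
    D.base.π ((χ k s : ℂ) • θ k (f s)) (D.base.V s (D.U k ξ))
  rw [D.U_π, D.U_V, map_smul, map_smul, smul_apply]

variable (μ) in
/-- The covariant representation of the crossed product. -/
def toCovRep [LocallyCompactSpace G] (D : BiCovRep.{u, v, w} p α θ χ) :
    CovRep.{u, max u v, w} p (twistAction.{u, v, w} p μ θ hθ χ hχ) where
  X := D.base.X
  ν := D.base.ν
  π := D.base.integratedHom μ
  contractive := D.base.norm_integratedL_le
  nondegenerate := D.base.dense_integratedL
  V := D.U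
  continuous_V := D.continuous_U
  covariant k x ξ := by
    refine Eq.trans (D.U_integratedL hθ hχ k x (D.U k⁻¹ ξ)) ?_
    change D.base.integratedL μ (twistAction p μ θ hθ χ hχ k x) ((D.U k * D.U k⁻¹) ξ) = _
    rw [← map_mul, mul_inv_cancel, map_one]
    rfl

theorem integrated_toCovRep [LocallyCompactSpace G] (D : BiCovRep.{u, v, w} p α θ χ)
    (F : C_c(K × G, A)) (ξ : D.base.E) :
    (D.toCovRep μ hθ hχ).integrated κ (sectionMap p μ α F) ξ = D.int μ κ F ξ := by
  refine integral_congr_ae (Filter.Eventually.of_forall fun k => ?_)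
  change D.base.integratedL μ (LpCrossedProduct.ofFn p μ α (sectionFn F k)) (D.U k ξ) = _
  rw [D.base.integratedL_ofFn]
  rfl

/-- The disintegration of a covariant representation of the crossed product. -/
def ofCovRep [LocallyCompactSpace G]
    (ρ : CovRep.{u, max u v, w} p (twistAction.{u, v, w} p μ θ hθ χ hχ)) :
    BiCovRep.{u, v, w} p α θ χ where
  base := LpCrossedProduct.disintegrate ρ.ν ρ.π ρ.contractive ρ.nondegenerate
  U := ρ.V
  continuous_U := ρ.continuous_V
  -- Both relations are tested on the dense span of the vectors `ρ.π x ξ`, where they reduce to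
  -- `twistIso_mulShift`: here at group element `1`, with `χ_k(1) = 1`, and below at algebra element
  -- `1`, with `θ_k(1) = 1`.
  U_π k a ξ := by
    let T : ρ.E →L[ℂ] ρ.E := (ρ.V k).toContinuousLinearEquiv.toContinuousLinearMap
    let P := LpCrossedProduct.repAOp ρ.contractive ρ.nondegenerate
    have h : T * P a = P (θ k a) * T := by
      refine eq_of_nondegenerate ρ.nondegenerate fun x ξ => ?_
      change ρ.V k (P a (ρ.π x ξ)) = P (θ k a) (ρ.V k (ρ.π x ξ))
      simp only [P, LpCrossedProduct.repAOp_apply, ρ.V_π]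
      congr 2
      refine (LpCrossedProduct.twistIso_mulShift _ _ (θ.map_mul' k) (hθ k) a 1 x).trans ?_
      rw [map_one, Circle.coe_one, one_smul]
      rfl
    exact DFunLike.congr_fun h ξ
  U_V k s ξ := by
    let T : ρ.E →L[ℂ] ρ.E := (ρ.V k).toContinuousLinearEquiv.toContinuousLinearMap
    let Q := LpCrossedProduct.repGOp ρ.contractive ρ.nondegenerate
    have h : T * Q s = (χ k s : ℂ) • (Q s * T) := by
      refine eq_of_nondegenerate ρ.nondegenerate fun x ξ => ?_
      change ρ.V k (Q s (ρ.π x ξ)) = (χ k s : ℂ) • Q s (ρ.V k (ρ.π x ξ))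
      simp only [Q, LpCrossedProduct.repGOp_apply, ρ.V_π]
      rw [← smul_apply, ← map_smul]
      congr 2
      refine (LpCrossedProduct.twistIso_mulShift _ _ (θ.map_mul' k) (hθ k) 1 s x).trans ?_
      rw [θ.apply_one]
      rfl
    exact DFunLike.congr_fun h ξ

theorem int_ofCovRep [LocallyCompactSpace G]
    (ρ : CovRep.{u, max u v, w} p (twistAction.{u, v, w} p μ θ hθ χ hχ))
    (F : C_c(K × G, A)) (ξ : ρ.E) :
    (ofCovRep hθ hχ ρ).int μ κ F ξ = ρ.integrated κ (sectionMap p μ α F) ξ := by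
  refine integral_congr_ae (Filter.Eventually.of_forall fun k => ?_)
  exact DFunLike.congr_fun (LpCrossedProduct.integrated_disintegrate ρ.ν ρ.π ρ.contractive
    ρ.nondegenerate (sectionFn F k)) (ρ.V k ξ)

end BiCovRep

variable {α : IsoAction G A} {θ : IsoAction K A} {χ : K →* PontryaginDual G}
  [IsTopologicalGroup G] [MeasurableSpace G] [BorelSpace G]
  [IsTopologicalGroup K] [MeasurableSpace K] [BorelSpace K]
  [LocallyCompactSpace G] [LocallyCompactSpace K]
  [CompleteSpace A] {μ : Measure G} [μ.IsHaarMeasure] {κ : Measure K} [κ.IsHaarMeasure]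

/-- The crossed product iterated in one order acts on the space of every covariant representation of
the crossed product iterated in the other order. -/
theorem CovRep.exists_swap {hθ : ∀ k s a, θ k (α s a) = α s (θ k a)}
    {hχ : Continuous fun q : K × G => χ q.1 q.2}
    (ρ : CovRep.{u, max u v, w} p (twistAction.{u, v, w} p μ θ hθ χ hχ))
    {χ' : G →* PontryaginDual K} (hθ' : ∀ s k a, α s (θ k a) = θ k (α s a))
    (hχ' : Continuous fun q : G × K => χ' q.1 q.2) (hχχ' : ∀ k s, χ' s k = (χ k s)⁻¹) :
    ∃ σ : LpCrossedProduct.{u, max u v, w} p μ (twistAction.{u, v, w} p κ α hθ' χ' hχ') →ₙₐ[ℂ]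
        (ρ.E →L[ℂ] ρ.E), (∀ x, ‖σ x‖ ≤ ‖x‖) ∧
      ∀ (F : C_c(K × G, A)) (F' : C_c(G × K, A)),
        (∀ k s, F' (s, k) = (χ' s k : ℂ) • F (k, s)) →
        σ (LpCrossedProduct.ofFn p μ _ (sectionMap p κ θ F')) =
          ρ.integrated κ (sectionMap p μ α F) := by
  -- Disintegrate to the triple `(π, V, U)`, then integrate it in the opposite order on the same
  -- space.
  let D := BiCovRep.ofCovRep hθ hχ ρ
  let ρ' := (D.swap χ' hχχ').toCovRep κ hθ' hχ'
  refine ⟨ρ'.integratedHom μ, fun x => ρ'.norm_integratedL_le x, fun F F' hF => ?_⟩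
  ext1 ξ
  refine Eq.trans ?_ ((D.int_swap χ' hχχ' F F' hF ξ).trans (BiCovRep.int_ofCovRep hθ hχ ρ F ξ))
  refine Eq.trans ?_ ((D.swap χ' hχχ').integrated_toCovRep hθ' hχ' F' ξ)
  exact DFunLike.congr_fun (ρ'.integratedL_ofFn (sectionMap p κ θ F')) ξ

end Iterated

/-! ### Density of the functions of two variables -/

section Density

open LpCrossedProduct

variable {p : ℝ≥0∞} [Fact (1 ≤ p)] {G K : Type u} [Group G] [TopologicalSpace G]
  [Group K] [TopologicalSpace K] [T2Space K]
  [IsTopologicalGroup G] [MeasurableSpace G] [BorelSpace G]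
  [IsTopologicalGroup K] [MeasurableSpace K] [BorelSpace K] [LocallyCompactSpace K]
  {A : Type v} [NormedRing A] [NormedAlgebra ℂ A] [CompleteSpace A]
  {μ : Measure G} [μ.IsHaarMeasure] {α : IsoAction G A}

/-- The function `(k, s) ↦ φ(k) f(s)`. -/
def tensorFn {φ : K → ℝ} (hφ : Continuous φ) (hφ' : HasCompactSupport φ) (f : C_c(G, A)) :
    C_c(K × G, A) where
  toFun q := (φ q.1 : ℂ) • f q.2
  continuous_toFun := by
    have := f.continuous
    fun_prop
  hasCompactSupport' := HasCompactSupport.intro (hφ'.isCompact.prod f.hasCompactSupport.isCompact)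
    fun q hq => by
      rw [Set.mem_prod, not_and_or] at hq
      rcases hq with h | h
      · rw [image_eq_zero_of_notMem_tsupport h, Complex.ofReal_zero, zero_smul]
      · rw [image_eq_zero_of_notMem_tsupport h, smul_zero]

variable (p μ α) in
/-- `sectionMap` as a linear map. -/
def sectionMapₗ : C_c(K × G, A) →ₗ[ℂ] C_c(K, LpCrossedProduct.{u, v, w} p μ α) where
  toFun := sectionMap p μ α
  map_add' F F' := by
    ext k
    exact map_add (ofFnₗ.{u, v, w} p μ α) (sectionFn F k) (sectionFn F' k)
  map_smul' c F := by
    ext k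
    exact map_smul (ofFnₗ.{u, v, w} p μ α) c (sectionFn F k)

theorem sectionMap_tensorFn {φ : K → ℝ} (hφ : Continuous φ) (hφ' : HasCompactSupport φ)
    (f : C_c(G, A)) (k : K) :
    sectionMap.{u, v, w} p μ α (tensorFn hφ hφ' f) k = (φ k : ℂ) • ofFn p μ α f :=
  map_smul (ofFnₗ.{u, v, w} p μ α) (φ k : ℂ) f

/-- A continuous compactly supported function with values in a crossed product is uniformly
approximated, with control of the supports, by functions of two variables. -/
theorem exists_sectionMap_near (h : C_c(K, LpCrossedProduct.{u, v, w} p μ α)) {N : Set K}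
    (hN : tsupport h ⊆ interior N) {δ : ℝ} (hδ : 0 < δ) :
    ∃ F : C_c(K × G, A), (∀ k, ‖h k - sectionMap p μ α F k‖ ≤ δ) ∧
      ∀ k ∉ N, h k - sectionMap p μ α F k = 0 := by
  -- On `W f` the constant `f` is a `δ`-approximation of `h`; a partition of unity glues finitely
  -- many of these constants. The intersection with `interior N` controls the support.
  let W : C_c(G, A) → Set K := fun f => {k | dist (h k) (ofFn p μ α f) < δ} ∩ interior N
  have hWo : ∀ f, IsOpen (W f) := fun f =>
    (isOpen_lt (h.continuous.dist continuous_const) continuous_const).inter isOpen_interior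
  have hW : tsupport h ⊆ ⋃ f, W f := fun k hk => by
    obtain ⟨f, hf⟩ := (denseRange_ofFn p μ α).exists_dist_lt (h k) hδ
    exact Set.mem_iUnion.2 ⟨f, hf, hN hk⟩
  obtain ⟨t, ht⟩ := h.hasCompactSupport.isCompact.elim_finite_subcover W hWo hW
  obtain ⟨φ, hφ, hφc⟩ := PartitionOfUnity.exists_isSubordinate_of_locallyFinite_t2space
    h.hasCompactSupport.isCompact (fun i : t => W i) (fun i => hWo i)
    (locallyFinite_of_finite _) (by simpa [Set.iUnion_subtype] using ht)
  let F : C_c(K × G, A) := ∑ i : t, tensorFn (φ i).continuous (hφc i) i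
  have hF : ∀ k, sectionMap p μ α F k = ∑ i : t, (φ i k : ℂ) • ofFn p μ α (i : C_c(G, A)) :=
    fun k => by
      have h1 : sectionMap p μ α F =
          ∑ i : t, sectionMap p μ α (tensorFn (φ i).continuous (hφc i) i) :=
        map_sum (sectionMapₗ p μ α) _ _
      rw [h1, CompactlySupportedContinuousMap.coe_sum, Finset.sum_apply]
      simp only [sectionMap_tensorFn]
  -- The partition sums to one only on `tsupport h`; elsewhere both sides vanish.
  have hsum : ∀ k, h k = ∑ i : t, (φ i k : ℂ) • h k := fun k => by
    by_cases hk : k ∈ tsupport h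
    · have h1 := φ.sum_eq_one hk
      rw [finsum_eq_sum_of_fintype] at h1
      rw [← Finset.sum_smul, ← Complex.ofReal_sum, h1, Complex.ofReal_one, one_smul]
    · simp [image_eq_zero_of_notMem_tsupport hk]
  have hle : ∀ k, ∑ i : t, φ i k ≤ 1 := fun k => by
    have h1 := φ.sum_le_one k
    rwa [finsum_eq_sum_of_fintype] at h1
  have hmem : ∀ i : t, ∀ k, φ i k ≠ 0 → k ∈ W i := fun i k hk => hφ i (subset_tsupport _ hk)
  have hdiff : ∀ k, h k - sectionMap p μ α F k =
      ∑ i : t, (φ i k : ℂ) • (h k - ofFn p μ α (i : C_c(G, A))) := fun k => by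
    simp only [smul_sub, Finset.sum_sub_distrib]
    rw [← hsum, hF]
  refine ⟨F, fun k => ?_, fun k hk => ?_⟩
  · rw [hdiff]
    refine (norm_sum_le_of_le _ fun i _ => ?_).trans
      ((Finset.sum_mul Finset.univ (fun i : t => φ i k) δ).symm.trans_le
        (mul_le_of_le_one_left hδ.le (hle k)))
    rw [norm_smul, Complex.norm_real, Real.norm_of_nonneg (φ.nonneg i k)]
    by_cases hi : φ i k = 0
    · simp [hi]
    · rw [← dist_eq_norm]
      exact mul_le_mul_of_nonneg_left (hmem i k hi).1.le (φ.nonneg i k)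
  · rw [hdiff]
    refine Finset.sum_eq_zero fun i _ => ?_
    have : φ i k = 0 := by_contra fun hi => hk (interior_subset (hmem i k hi).2)
    rw [this, Complex.ofReal_zero, zero_smul]

theorem denseRange_sectionMap (κ : Measure K) [κ.IsHaarMeasure]
    (τ : IsoAction K (LpCrossedProduct.{u, v, w} p μ α)) :
    DenseRange fun F : C_c(K × G, A) =>
      ofFn.{u, max u v, w} p κ τ (sectionMap p μ α F) := by
  intro x
  rw [Metric.mem_closure_iff]
  intro ε hε
  obtain ⟨h, hh⟩ := (denseRange_ofFn p κ τ).exists_dist_lt x (ε := ε / 2) (by positivity)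
  obtain ⟨N, hN, hsN⟩ := exists_compact_superset h.hasCompactSupport.isCompact
  have hpos : 0 < κ.real N + 1 := by positivity
  -- The error is at most `δ` and lives on `N`, so its `L^1` norm is at most `δ κ(N)`. Adding one to
  -- `κ(N)` keeps the quotient defined when `N` is null.
  obtain ⟨F, hF1, hF2⟩ := exists_sectionMap_near h hsN
    (δ := ε / 2 / (κ.real N + 1)) (by positivity)
  refine ⟨_, ⟨F, rfl⟩, ?_⟩
  have h1 : dist (ofFn p κ τ h) (ofFn p κ τ (sectionMap p μ α F)) ≤ ε / 2 := by
    rw [dist_eq_norm, ← ofFnₗ_apply, ← ofFnₗ_apply, ← map_sub]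
    refine (norm_ofFn_le_integral _).trans ?_
    have h2 : ∫ k, ‖(h - sectionMap p μ α F) k‖ ∂κ =
        ∫ k in N, ‖(h - sectionMap p μ α F) k‖ ∂κ :=
      (setIntegral_eq_integral_of_forall_compl_eq_zero fun k hk => by
        exact norm_eq_zero.2 (hF2 k hk)).symm
    refine h2.trans_le ?_
    have h3 := norm_setIntegral_le_of_norm_le_const (μ := κ) (s := N)
      (f := fun k => ‖(h - sectionMap p μ α F) k‖) hN.measure_lt_top
      (fun k _ => (norm_norm _).trans_le (hF1 k))
    refine (le_abs_self _).trans (h3.trans ?_)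
    rw [div_mul_eq_mul_div, div_le_iff₀ hpos]
    nlinarith
  calc dist x (ofFn p κ τ (sectionMap p μ α F)) ≤ dist x (ofFn p κ τ h) +
        dist (ofFn p κ τ h) (ofFn p κ τ (sectionMap p μ α F)) := dist_triangle _ _ _
    _ < ε := by linarith

end Density

/-! ### The isomorphism between the two iterated crossed products. -/

section LabelChange

open LpCrossedProduct

variable {p : ℝ≥0∞} [Fact (1 ≤ p)] {G K : Type u} [Group G] [TopologicalSpace G]
  [Group K] [TopologicalSpace K] [T2Space G] [T2Space K]
  [IsTopologicalGroup G] [MeasurableSpace G] [BorelSpace G] [LocallyCompactSpace G]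
  [IsTopologicalGroup K] [MeasurableSpace K] [BorelSpace K] [LocallyCompactSpace K]
  {A : Type v} [NormedRing A] [NormedAlgebra ℂ A] [CompleteSpace A]
  {μ : Measure G} [μ.IsHaarMeasure] {κ : Measure K} [κ.IsHaarMeasure]
  {α : IsoAction G A} {θ : IsoAction K A}

/-- Every covariant representation entering the left-hand supremum yields, by `CovRep.exists_swap`,
a contractive homomorphism of the other algebra taking the same value on `F'`. The hypotheses are
symmetric in the two groups, so the reverse inequality is another instance. -/
theorem norm_ofFn_sectionMap_le {χ : K →* PontryaginDual G}
    {hθ : ∀ k s a, θ k (α s a) = α s (θ k a)}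
    {hχ : Continuous fun q : K × G => χ q.1 q.2} {χ' : G →* PontryaginDual K}
    {hθ' : ∀ s k a, α s (θ k a) = θ k (α s a)}
    {hχ' : Continuous fun q : G × K => χ' q.1 q.2} (hχχ' : ∀ k s, χ' s k = (χ k s)⁻¹)
    {F : C_c(K × G, A)} {F' : C_c(G × K, A)} (hF : ∀ k s, F' (s, k) = (χ' s k : ℂ) • F (k, s)) :
    ‖ofFn.{u, max u v, w} p κ (twistAction.{u, v, w} p μ θ hθ χ hχ) (sectionMap p μ α F)‖ ≤
      ‖ofFn.{u, max u v, w} p μ (twistAction.{u, v, w} p κ α hθ' χ' hχ') (sectionMap p κ θ F')‖ := by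
  refine norm_le_of_forall_integratedL (norm_nonneg _) fun ρ => ?_
  obtain ⟨σ, hσ, h⟩ := ρ.exists_swap (κ := κ) hθ' hχ' hχχ'
  rw [ρ.integratedL_ofFn, ← h F F' hF]
  exact hσ _

/-- Two crossed products iterated in different orders are isometrically isomorphic, by an
isomorphism extending a given linear bijection of the spaces of functions of two variables. -/
theorem exists_iterated_iso {χ : K →* PontryaginDual G}
    {hθ : ∀ k s a, θ k (α s a) = α s (θ k a)}
    {hχ : Continuous fun q : K × G => χ q.1 q.2} {χ' : G →* PontryaginDual K}
    {hθ' : ∀ s k a, α s (θ k a) = θ k (α s a)}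
    {hχ' : Continuous fun q : G × K => χ' q.1 q.2} (hχχ' : ∀ k s, χ' s k = (χ k s)⁻¹)
    (T : C_c(K × G, A) ≃ₗ[ℂ] C_c(G × K, A)) (hT : ∀ F k s, T F (s, k) = (χ' s k : ℂ) • F (k, s)) :
    ∃! Φ : LpCrossedProduct.{u, max u v, w} p κ (twistAction.{u, v, w} p μ θ hθ χ hχ) ≃ₗᵢ[ℂ]
        LpCrossedProduct.{u, max u v, w} p μ (twistAction.{u, v, w} p κ α hθ' χ' hχ'),
      (∀ x y, Φ (x * y) = Φ x * Φ y) ∧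
      ∀ F : C_c(K × G, A), Φ (ofFn p κ _ (sectionMap p μ α F)) =
        ofFn p μ _ (sectionMap p κ θ (T F)) := by
  let ι₁ := ofFnₗ.{u, max u v, w} p κ (twistAction.{u, v, w} p μ θ hθ χ hχ) ∘ₗ sectionMapₗ p μ α
  let ι₂ := ofFnₗ.{u, max u v, w} p μ (twistAction.{u, v, w} p κ α hθ' χ' hχ') ∘ₗ sectionMapₗ p κ θ
  have hι₁ : DenseRange ι₁ := denseRange_sectionMap κ _
  have hι₂ : DenseRange ι₂ := denseRange_sectionMap μ _
  have hnorm : ∀ F, ‖ι₂ (T F)‖ = ‖ι₁ F‖ := fun F => by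
    refine le_antisymm ?_ (norm_ofFn_sectionMap_le hχχ' (hT F))
    refine norm_ofFn_sectionMap_le (fun s k => by rw [hχχ', inv_inv]) fun s k => ?_
    rw [hT, ← mul_smul, hχχ', ← Circle.coe_mul, mul_inv_cancel, Circle.coe_one, one_smul]
  let Φ := T.extendOfIsometry ι₁ ι₂ hι₁ hι₂ hnorm
  have hΦ : ∀ F, Φ (ι₁ F) = ι₂ (T F) := T.extendOfIsometry_eq ι₁ ι₂ hι₁ hι₂ hnorm
  refine ⟨Φ, ⟨fun x y => ?_, hΦ⟩, fun Ψ hΨ => ?_⟩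
  -- The equation is tested in each covariant representation `ρ` of the first algebra. The
  -- homomorphism `σ` with `σ ∘ Φ = ρ.integratedL κ` sends `Φ x * Φ y` to the product of the
  -- operators of `x` and `y`, so no convolution of two-variable functions has to be computed.
  · have key : x * y = Φ.symm (Φ x * Φ y) := by
      refine ext_integratedL fun ρ => ?_
      obtain ⟨σ, hσ, h⟩ := ρ.exists_swap (κ := κ) hθ' hχ' hχχ'
      have hσc : Continuous σ :=
        AddMonoidHomClass.continuous_of_bound σ 1 fun x => (hσ x).trans_eq (one_mul _).symm
      have h1 : ∀ x, σ (Φ x) = ρ.integratedL κ x := fun x => by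
        refine hι₁.induction_on x (isClosed_eq (hσc.comp Φ.continuous)
          (ρ.integratedL κ).continuous) fun F => ?_
        rw [hΦ]
        exact (h F (T F) (hT F)).trans (ρ.integratedL_ofFn _).symm
      rw [← h1 (Φ.symm _), LinearIsometryEquiv.apply_symm_apply, ρ.integratedL_mul,
        map_mul σ, h1, h1]
    rw [key, LinearIsometryEquiv.apply_symm_apply]
  · refine LinearIsometryEquiv.ext fun x => ?_
    refine hι₁.induction_on x (isClosed_eq Ψ.continuous Φ.continuous) fun F => ?_
    exact (hΨ.2 F).trans (hΦ F).symm

end LabelChange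

/-! ### The label change as a bijection of function spaces. -/

section Dual

variable {G : Type u} [CommGroup G] [TopologicalSpace G]
  [IsTopologicalGroup G] [LocallyCompactSpace G] [MeasurableSpace G]
  {A : Type v} [NormedRing A] [NormedAlgebra ℂ A] [CompleteSpace A]

/-- The inverse `F(γ, s) = conj(γ(s)) F'(s, γ)` of the label change. -/
def labelChangeInv (F : C_c(G × PontryaginDual G, A)) : C_c(PontryaginDual G × G, A) where
  toFun q := ((q.1 q.2)⁻¹ : Circle) • F (q.2, q.1)
  continuous_toFun :=
    (continuous_dual_apply (G := G)).inv.smul (F.continuous.comp continuous_swap)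
  hasCompactSupport' :=
    (F.hasCompactSupport.comp_homeomorph (Homeomorph.prodComm (PontryaginDual G) G)).smul_left

/-- The label change as a linear bijection. -/
def labelChangeₗ :
    C_c(PontryaginDual G × G, A) ≃ₗ[ℂ] C_c(G × PontryaginDual G, A) where
  toFun := labelChange
  map_add' F F' := by
    ext ⟨s, γ⟩
    exact smul_add _ _ _
  map_smul' c F := by
    ext ⟨s, γ⟩
    exact smul_comm _ _ _
  invFun := labelChangeInv
  left_inv F := by
    ext ⟨γ, s⟩
    exact inv_smul_smul (γ s) (F (γ, s))
  right_inv F := by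
    ext ⟨s, γ⟩
    exact smul_inv_smul (γ s) (F (s, γ))

end Dual

end LpCrossed

end

theorem proposition3p1 (p : ℝ≥0∞) [Fact (1 ≤ p)] (hp : p ≠ ∞)
    {G : Type u} [CommGroup G] [Countable G] [TopologicalSpace G] [DiscreteTopology G]
    [MeasurableSpace G] [BorelSpace G]
    [MeasurableSpace (PontryaginDual G)] [BorelSpace (PontryaginDual G)]
    (m : Measure (PontryaginDual G)) [m.IsHaarMeasure] [IsProbabilityMeasure m]
    {A : Type v} [NormedRing A] [NormedAlgebra ℂ A] [CompleteSpace A]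
    [TopologicalSpace.SeparableSpace A]
    (hA : LpCrossed.IsLpOperatorAlgebra.{v, w} p A)
    (hunique : LpCrossed.HasUniqueLpMatrixNorms.{v, w} p A)
    (α : LpCrossed.IsoAction G A) :
    ∃! Φ : LpCrossed.LpCrossedProduct.{u, max u v, w} p m
          (LpCrossed.dualAction.{u, v, w} p Measure.count α) ≃ₗᵢ[ℂ]
        LpCrossed.LpCrossedProduct.{u, max u v, w} p Measure.count
          (LpCrossed.dualTensorAction.{u, v, w} p m α),
      (∀ x y, Φ (x * y) = Φ x * Φ y) ∧
      ∀ F : C_c(PontryaginDual G × G, A),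
        Φ (LpCrossed.LpCrossedProduct.ofFn p m _
            (LpCrossed.sectionMap p Measure.count α F)) =
          LpCrossed.LpCrossedProduct.ofFn p Measure.count _
            (LpCrossed.sectionMap p m (LpCrossed.IsoAction.trivial (PontryaginDual G) A)
              (LpCrossed.labelChange F)) :=
  -- The second group is the dual group with trivial action on `A`, `χ_γ = γ⁻¹`, and `χ'_s` is
  -- evaluation at `s`. The relation between the pairings is then `γ(s) = (γ(s)⁻¹)⁻¹`.
  LpCrossed.exists_iterated_iso (fun _ _ => (inv_inv _).symm) LpCrossed.labelChangeₗ
    fun F γ s => LpCrossed.labelChange_apply F s γ
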